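/- All Hilbert spaces are complex and finite-dimensional. For Hilbert spaces $\mathcal H,\mathcal K$ let $\mathcal B_1(\mathcal H)$ be the space of (trace-class) operators on $\mathcal H$, and call a completely positive, trace-preserving linear map $\mathcal B_1(\mathcal H)\to\mathcal B_1(\mathcal K)$ a channel. A state is a positive semi-definite operator of trace $1$. For a subspace $\mathcal V\subseteq\mathcal H$, $\mathcal B_1(\mathcal V)\subseteq\mathcal B_1(\mathcal H)$ denotes the operators with range and support (the orthogonal complement of the kernel) in $\mathcal V$. A channel $T$ on $\mathcal B_1(\mathcal H)$ is isometric on $\mathcal V$ if there is an isometry $W:\mathcal V\to\mathcal H$ with $T(X)=WXW^\dagger$ for all $X\in\mathcal B_1(\mathcal V)$. A superchannel is a linear map $R$ from the linear maps on $\mathcal B_1(\mathcal H)$ to the linear maps on $\mathcal B_1(\mathcal H_Q)$ of the form $R(T')=R_0'\circ(T'\otimes\mathrm{id}_A)\circ R_0$, with a Hilbert space $\mathcal H_A$ and channels $R_0:\mathcal B_1(\mathcal H_Q)\to\mathcal B_1(\mathcal H\otimes\mathcal H_A)$ and $R_0':\mathcal B_1(\mathcal H\otimes\mathcal H_A)\to\mathcal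 B_1(\mathcal H_Q)$. A channel with transmission functional is a channel $T'$ on $\mathcal B_1(\mathcal H)$ together with a positive linear functional $\mathfrak t_{T'}$ on $\mathcal B_1(\mathcal H)$; the superchannel $R$ transforms $\mathfrak t_{T'}$ into $\mathfrak t_{R(T')}:=\mathfrak t_{T'}\circ\mathrm{tr}_A\circ R_0$. **Theorem 4.9 (Reduction superchannel).** Let $T:\mathcal B_1(\mathcal H)\to\mathcal B_1(\mathcal H)$ be a channel, let $\mathcal V\subseteq\mathcal H$ be a subspace such that $T$ is isometric on $\mathcal V$, let $v\in\mathcal V$ be a unit vector, and let $\mathcal H_Q$ be a two-dimensional Hilbert space with orthonormal basis $\{q_0,q_1\}$. Let $d:=\dim\mathcal V$ and let $P^\perp$ be the orthogonal projection of $\mathcal H$ onto $\{\psi\in\mathcal V:\langle\psi,v\rangle=0\}$. Then there is a superchannel $R$, from linear maps on $\mathcal B_1(\mathcal H)$ to linear maps on $\mathcal B_1(\mathcal H_Q)$, with the following properties. 1. If $T'$ is a linear map on $\mathcal B_1(\mathcal H)$ with $T'|_{\mathcal B_1(\mathcal V)}=T|_{\mathcal B_1(\mathcal V)}$, then $R(T')=\mathrm{id}$.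 2. If $T'$ is a channel on $\mathcal B_1(\mathcal H)$ with $T'|_{\mathcal B_1(\mathcal V)}\neq T|_{\mathcal B_1(\mathcal V)}$, then $R(T')$ is a channel, and $|q_0\rangle\langle q_0|$ is the one and only state that is a fixed point of $R(T')$. 3. If $T'$ is a channel on $\mathcal B_1(\mathcal H)$ with transmission functional $\mathfrak t_{T'}$ and $\mathfrak t_{T'}(|v\rangle\langle v|)=0$, then, for every choice of $\mathcal H_A,R_0,R_0'$ that implements $R$, $$\mathfrak t_{R(T')}(\sigma)=\begin{cases}\tfrac12\,\mathfrak t_{T'}\!\left(\frac{P^\perp}{d-1}\right)\operatorname{tr}\big(|q_1\rangle\langle q_1|\,\sigma\big)&\text{if } d>1,\\[2pt] 0&\text{if } d=1,\end{cases}\qquad \sigma\in\mathcal B_1(\mathcal H_Q).$$ Moreover, $R$ can be built from one ancillary qubit and twirling with classical randomness: there are channels $E:\mathcal B_1(\mathcal H_Q)\to\mathcal B_1(\mathcal H\otimes\mathbb C^2)$, $C:\mathcal B_1(\mathcal H)\to\mathcal B_1(\mathcal H)$ and $D:\mathcal B_1(\mathcal H\otimes\mathbb C^2)\to\mathcal B_1(\mathcal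 H_Q)$, finitely many probabilities $p_k\ge 0$ with $\sum_kp_k=1$, and unitaries $U_k$ on $\mathcal H$ that fix $v$ and every vector of $\mathcal V^\perp$, such that, with $\hat U_k(X):=U_kXU_k^\dagger$, for every linear map $T'$ on $\mathcal B_1(\mathcal H)$ $$R(T')=\sum_k p_k\; D\circ\Big(\big(\hat U_k\circ C\circ T'\circ\hat U_k^{-1}\big)\otimes\mathrm{id}_{\mathbb C^2}\Big)\circ E .$$ -/

import Mathlib

open scoped TensorProduct ComplexOrder

namespace QChan

noncomputable section

/-- Operators on `H`. In finite dimension this is the space of trace-class operators, and every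
linear map between such spaces is bounded. -/
abbrev Op (H : Type*) [AddCommGroup H] [Module ℂ H] : Type _ := H →ₗ[ℂ] H

/-- Linear maps from operators on `H` to operators on `K`. -/
abbrev SuperOp (H K : Type*) [AddCommGroup H] [Module ℂ H] [AddCommGroup K] [Module ℂ K] :
    Type _ := Op H →ₗ[ℂ] Op K

/-- The `n`-dimensional Hilbert space, used for ancillary systems. -/
abbrev Anc (n : ℕ) : Type := EuclideanSpace ℂ (Fin n)

section

variable {H K : Type*} [NormedAddCommGroup H] [InnerProductSpace ℂ H] [FiniteDimensional ℂ H]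
  [NormedAddCommGroup K] [InnerProductSpace ℂ K] [FiniteDimensional ℂ K]

/-- The map `T ⊗ id` with an `n`-dimensional ancilla, i.e. the linear map which sends
`X ⊗ Y` to `T X ⊗ Y` (see `ampl_map`). -/
def ampl (n : ℕ) (T : SuperOp H K) : SuperOp (H ⊗[ℂ] Anc n) (K ⊗[ℂ] Anc n) :=
  (homTensorHomEquiv ℂ K (Anc n) K (Anc n)).toLinearMap ∘ₗ
    LinearMap.rTensor (Op (Anc n)) T ∘ₗ
      (homTensorHomEquiv ℂ H (Anc n) H (Anc n)).symm.toLinearMap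

theorem ampl_map (n : ℕ) (T : SuperOp H K) (X : Op H) (Y : Op (Anc n)) :
    ampl n T (TensorProduct.map X Y) = TensorProduct.map (T X) Y := by
  have h : (homTensorHomEquiv ℂ H (Anc n) H (Anc n)).symm (TensorProduct.map X Y)
      = X ⊗ₜ[ℂ] Y := by
    rw [LinearEquiv.symm_apply_eq]
    simp [homTensorHomEquiv_apply]
  simp [ampl, h]

/-- The partial trace over the ancilla: the linear map which sends `X ⊗ Y` to `tr(Y) X`
(see `ptrace_map`). -/
def ptrace (n : ℕ) : SuperOp (H ⊗[ℂ] Anc n) H :=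
  (TensorProduct.rid ℂ (Op H)).toLinearMap ∘ₗ
    LinearMap.lTensor (Op H) (LinearMap.trace ℂ (Anc n)) ∘ₗ
      (homTensorHomEquiv ℂ H (Anc n) H (Anc n)).symm.toLinearMap

theorem ptrace_map (n : ℕ) (X : Op H) (Y : Op (Anc n)) :
    ptrace n (TensorProduct.map X Y) = LinearMap.trace ℂ (Anc n) Y • X := by
  have h : (homTensorHomEquiv ℂ H (Anc n) H (Anc n)).symm (TensorProduct.map X Y)
      = X ⊗ₜ[ℂ] Y := by
    rw [LinearEquiv.symm_apply_eq]
    simp [homTensorHomEquiv_apply]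
  simp [ptrace, h]

/-- `|x⟩⟨x|`. -/
def ketbra (x : H) : Op H := (InnerProductSpace.rankOne ℂ x x).toLinearMap

/-- Complete positivity: all the maps `T ⊗ id` with a finite-dimensional ancilla are positive. -/
def IsCompletelyPositive (T : SuperOp H K) : Prop :=
  ∀ (n : ℕ) (X : Op (H ⊗[ℂ] Anc n)), X.IsPositive → (ampl n T X).IsPositive

/-- A quantum channel: completely positive and trace-preserving. -/
def IsChannel (T : SuperOp H K) : Prop :=
  IsCompletelyPositive T ∧ ∀ X : Op H, LinearMap.trace ℂ K (T X) = LinearMap.trace ℂ H X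

/-- A quantum state (density operator). -/
def IsState (ρ : Op H) : Prop := ρ.IsPositive ∧ LinearMap.trace ℂ H ρ = 1

/-- The operators on `H` whose range and support lie in `V`, where the support of `X` is the
orthogonal complement of its kernel. -/
def opsIn (V : Submodule ℂ H) : Set (Op H) :=
  {X | LinearMap.range X ≤ V ∧ (LinearMap.ker X)ᗮ ≤ V}

/-- An operator on `H` cut down to an operator on `V`; for `X ∈ opsIn V` this is `X` itself,
regarded as an operator on `V`. -/
def toOpOn (V : Submodule ℂ H) (X : Op H) : Op V :=
  LinearMap.adjoint V.subtype ∘ₗ X ∘ₗ V.subtype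

/-- `T` acts on operators on `V` as `X ↦ W X W†` for some isometry `W : V → H`. -/
def IsIsometricOn (T : SuperOp H H) (V : Submodule ℂ H) : Prop :=
  ∃ W : V →ₗᵢ[ℂ] H, ∀ X ∈ opsIn V,
    T X = W.toLinearMap ∘ₗ toOpOn V X ∘ₗ LinearMap.adjoint W.toLinearMap

/-- A channel `T` together with a transmission functional `t`, i.e. a positive linear
functional. -/
def IsChannelWithTransmission (T : SuperOp H H) (t : Op H →ₗ[ℂ] ℂ) : Prop :=
  IsChannel T ∧ ∀ X : Op H, X.IsPositive → 0 ≤ t X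

end

section

variable {H Q : Type*} [NormedAddCommGroup H] [InnerProductSpace ℂ H] [FiniteDimensional ℂ H]
  [NormedAddCommGroup Q] [InnerProductSpace ℂ Q] [FiniteDimensional ℂ Q]

/-- The channels `R₀` and `R₀'` implement `R` with an `n`-dimensional ancilla:
`R(T) = R₀' (T ⊗ id) R₀`. -/
def IsImplementation (R : SuperOp H H →ₗ[ℂ] SuperOp Q Q) (n : ℕ)
    (R₀ : SuperOp Q (H ⊗[ℂ] Anc n)) (R₀' : SuperOp (H ⊗[ℂ] Anc n) Q) : Prop :=
  IsChannel R₀ ∧ IsChannel R₀' ∧ ∀ T : SuperOp H H, R T = R₀' ∘ₗ ampl n T ∘ₗ R₀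

/-- A superchannel: a map `T ↦ R₀' (T ⊗ id) R₀` with channels `R₀` and `R₀'`. -/
def IsSuperchannel (R : SuperOp H H →ₗ[ℂ] SuperOp Q Q) : Prop :=
  ∃ n R₀ R₀', IsImplementation R n R₀ R₀'

/-- The superchannel `R` transforms the transmission functional `t` into `t'`. The transformed
functional is `t ∘ tr_A ∘ R₀`; it is required to be `t'` for every implementation of `R`. -/
def TransformsFunctional (R : SuperOp H H →ₗ[ℂ] SuperOp Q Q) (t : Op H →ₗ[ℂ] ℂ)
    (t' : Op Q →ₗ[ℂ] ℂ) : Prop :=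
  ∀ n R₀ R₀', IsImplementation R n R₀ R₀' → t ∘ₗ ptrace n ∘ₗ R₀ = t'

/-- `R` is built from one ancillary qubit and twirling: there are channels `E`, `C`, `D` and
unitaries `U k`, drawn at random with probabilities `p k`, each of which fixes `v` and all vectors
orthogonal to `V` (that is, it is `1 ⊕ U' ⊕ 1` with respect to the decomposition
`span{v} ⊕ (V ⊖ span{v}) ⊕ Vᗮ`), such that
`R(T) = ∑ k, p k • D ((Û_k C T Û_k⁻¹) ⊗ id) E`, where `Û_k` is conjugation by `U k`. -/
def IsOneQubitTwirl (V : Submodule ℂ H) (v : H) (R : SuperOp H H →ₗ[ℂ] SuperOp Q Q) : Prop :=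
  ∃ (E : SuperOp Q (H ⊗[ℂ] Anc 2)) (C : SuperOp H H) (D : SuperOp (H ⊗[ℂ] Anc 2) Q)
    (N : ℕ) (p : Fin N → ℝ) (U : Fin N → H ≃ₗᵢ[ℂ] H),
    IsChannel E ∧ IsChannel C ∧ IsChannel D ∧
    (∀ k, 0 ≤ p k) ∧ ∑ k, p k = 1 ∧
    (∀ k, U k v = v ∧ ∀ x ∈ Vᗮ, U k x = x) ∧
    ∀ T : SuperOp H H, R T = ∑ k, (p k : ℂ) •
      (D ∘ₗ ampl 2 ((U k).toLinearEquiv.conj.toLinearMap ∘ₗ C ∘ₗ T ∘ₗ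
        (U k).symm.toLinearEquiv.conj.toLinearMap) ∘ₗ E)

/-- The functional `σ ↦ ½ t(P⊥ / (d - 1)) tr(|q⟩⟨q| σ)` if `d > 1`, and `0` if `d = 1`, where
`d = dim V` and `P⊥` is the orthogonal projection onto `{ψ ∈ V | ⟨ψ, v⟩ = 0}`. -/
def reducedFunctional (V : Submodule ℂ H) (v : H) (q : Q) (t : Op H →ₗ[ℂ] ℂ) : Op Q →ₗ[ℂ] ℂ :=
  if 1 < Module.finrank ℂ V then
    ((1 / 2 : ℂ) * t ((1 / ((Module.finrank ℂ V : ℂ) - 1)) •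
      (V ⊓ (ℂ ∙ v)ᗮ).starProjection.toLinearMap)) •
      (LinearMap.trace ℂ Q ∘ₗ LinearMap.mulLeft ℂ (ketbra q))
  else 0

end

end

end QChan

open QChan

/-! Channels and superchannels in finite dimension: dyads, conjugation maps, recovery maps, twirls. -/

/-! Encode `q 0` as `v ⊗ e₀` and `q 1` as `χ ⊗ e₁`, where `χ = (v + ψ)/√2` with a unit vector `ψ` of
`V` orthogonal to `v` (and `χ = v` if `V` is a line). On `H`, apply `U_k⁻¹`, then `T'`, then a
channel `C` that undoes the isometry `W` of `T`, then `U_k`. The decoder `D` inverts the encoding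
and sends whatever lies outside its range to `|q₀⟩⟨q₀|`. If `T'` agrees with `T` on `V`, then `C ∘
T'` is the identity there, so the qubit returns intact. In general `R T'` multiplies each coherence
by a factor, keeps `|q₁⟩⟨q₁|` with a weight `c`, and moves the missing weight to `|q₀⟩⟨q₀|`; if `c ≠
1`, the only fixed state is `|q₀⟩⟨q₀|`.

It remains to see that `c = 1` forces agreement. The weight `c` averages the overlaps of `C (T'
|x_k⟩⟨x_k|)` with `x_k = U_k⁻¹ χ`, so each overlap is 1 and `T'` sends each `x_k` to the pure state
`W x_k`. Two non-orthogonal pure states mapped as by an isometry drag their coherence along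
(`IsChannel.apply_dyad`). The twirl of `exists_isTwirl` provides `x_k` that are pairwise
non-orthogonal and span `V`, which gives agreement on all operators on `V`.

For the transmission functional, `t ∘ tr_A ∘ R₀` is the trace of `R` applied to the map `X ↦ t(X) τ`
with `tr τ = 1`, so it depends on `R` alone. Positivity together with `t(|v⟩⟨v|) = 0` kills the
cross terms with `v`, and averaging the remaining `½ t(|ψ_k⟩⟨ψ_k|)` over an orthonormal basis gives
the maximally mixed state on the complement of `v` in `V`. -/

namespace QChan

noncomputable section

/-! ### Rank-one operators. -/

section Dyad

variable {H K L M : Type*} [NormedAddCommGroup H] [InnerProductSpace ℂ H]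
  [NormedAddCommGroup K] [InnerProductSpace ℂ K]
  [NormedAddCommGroup L] [InnerProductSpace ℂ L]
  [NormedAddCommGroup M] [InnerProductSpace ℂ M]

/-- `|x⟩⟨y|`. -/
def dyad (x : H) (y : K) : K →ₗ[ℂ] H := (InnerProductSpace.rankOne ℂ x y).toLinearMap

theorem dyad_apply (x : H) (y z : K) : dyad x y z = inner ℂ y z • x := rfl

theorem ketbra_eq_dyad (x : H) : ketbra x = dyad x x := rfl

theorem isPositive_dyad_self (x : H) : (dyad x x).IsPositive :=
  (ContinuousLinearMap.isPositive_toLinearMap_iff _).2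
    (InnerProductSpace.isPositive_rankOne_self x)

theorem comp_dyad (A : H →ₗ[ℂ] L) (x : H) (y : K) : A ∘ₗ dyad x y = dyad (A x) y := by
  ext z; simp [dyad_apply]

theorem dyad_comp [FiniteDimensional ℂ K] [FiniteDimensional ℂ L] (x : H) (y : K)
    (A : L →ₗ[ℂ] K) : dyad x y ∘ₗ A = dyad x (LinearMap.adjoint A y) := by
  ext z; simp [dyad_apply, LinearMap.adjoint_inner_left]

theorem adjoint_dyad [FiniteDimensional ℂ H] [FiniteDimensional ℂ K] (x : H) (y : K) :
    LinearMap.adjoint (dyad x y) = dyad y x := by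
  rw [eq_comm, LinearMap.eq_adjoint_iff]
  intro a b
  simp [dyad_apply, inner_smul_left, inner_smul_right, mul_comm]

theorem trace_dyad [FiniteDimensional ℂ H] (x y : H) :
    LinearMap.trace ℂ H (dyad x y) = inner ℂ y x :=
  InnerProductSpace.trace_rankOne x y

theorem map_dyad (x : H) (y : K) (a : L) (b : M) :
    TensorProduct.map (dyad x y) (dyad a b) = dyad (x ⊗ₜ[ℂ] a) (y ⊗ₜ[ℂ] b) := by
  ext z c
  simp [dyad_apply, ← TensorProduct.smul_tmul', smul_smul, mul_comm]

theorem dyad_add_left (x x' : H) (y : K) : dyad (x + x') y = dyad x y + dyad x' y := by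
  simp [dyad]

theorem dyad_add_right (x : H) (y y' : K) : dyad x (y + y') = dyad x y + dyad x y' := by
  simp [dyad]

theorem dyad_smul_left (c : ℂ) (x : H) (y : K) : dyad (c • x) y = c • dyad x y := by
  simp [dyad]

theorem dyad_smul_right (c : ℂ) (x : H) (y : K) :
    dyad x (c • y) = (starRingEnd ℂ) c • dyad x y := by
  simp [dyad]

theorem dyad_zero_left (y : K) : dyad (0 : H) y = 0 := by simp [dyad]

theorem sum_dyad_eq {ι : Type*} [Fintype ι] (b : OrthonormalBasis ι ℂ K) (X : K →ₗ[ℂ] H) :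
    X = ∑ i, dyad (X (b i)) (b i) := by
  ext z
  conv_lhs => rw [← b.sum_repr' z]
  simp [dyad_apply]

theorem sum_sum_dyad_eq {ι κ : Type*} [Fintype ι] [Fintype κ] (b : OrthonormalBasis ι ℂ K)
    (c : OrthonormalBasis κ ℂ H) (X : K →ₗ[ℂ] H) :
    X = ∑ i, ∑ j, inner ℂ (c j) (X (b i)) • dyad (c j) (b i) := by
  conv_lhs => rw [sum_dyad_eq b X]
  refine Finset.sum_congr rfl fun i _ ↦ ?_
  ext z
  conv_lhs => rw [← c.sum_repr' (X (b i))]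
  simp [dyad_apply, LinearMap.sum_apply, Finset.smul_sum, smul_smul, mul_comm]

theorem op_basis_ext {M : Type*} [AddCommGroup M] [Module ℂ M] {f g : Op H →ₗ[ℂ] M}
    {ι : Type*} [Fintype ι] (b : OrthonormalBasis ι ℂ H)
    (h : ∀ i j, f (dyad (b i) (b j)) = g (dyad (b i) (b j))) : f = g := by
  ext X
  rw [sum_sum_dyad_eq b b X]
  simp [h]

end Dyad

/-! ### Conjugation maps, ancillas and complete positivity. -/

section Ampl

variable {H K L : Type*} [NormedAddCommGroup H] [InnerProductSpace ℂ H] [FiniteDimensional ℂ H]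
  [NormedAddCommGroup K] [InnerProductSpace ℂ K] [FiniteDimensional ℂ K]
  [NormedAddCommGroup L] [InnerProductSpace ℂ L] [FiniteDimensional ℂ L]

theorem op_tensor_ext {M : Type*} [AddCommGroup M] [Module ℂ M]
    {f g : Op (H ⊗[ℂ] K) →ₗ[ℂ] M}
    (h : ∀ (X : Op H) (Y : Op K), f (TensorProduct.map X Y) = g (TensorProduct.map X Y)) :
    f = g := by
  have key : f ∘ₗ (homTensorHomEquiv ℂ H K H K).toLinearMap
      = g ∘ₗ (homTensorHomEquiv ℂ H K H K).toLinearMap := by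
    refine TensorProduct.ext' fun X Y ↦ ?_
    simpa [homTensorHomEquiv_apply] using h X Y
  ext Z
  have := LinearMap.congr_fun key ((homTensorHomEquiv ℂ H K H K).symm Z)
  rwa [LinearMap.comp_apply, LinearMap.comp_apply, LinearEquiv.coe_coe,
    LinearEquiv.apply_symm_apply] at this

/-- Conjugation `X ↦ A X A†`. -/
def ad (A : H →ₗ[ℂ] K) : SuperOp H K where
  toFun X := A ∘ₗ X ∘ₗ LinearMap.adjoint A
  map_add' X Y := by simp [LinearMap.comp_add, LinearMap.add_comp]
  map_smul' c X := by simp [LinearMap.comp_smul, LinearMap.smul_comp]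

theorem ad_apply (A : H →ₗ[ℂ] K) (X : Op H) : ad A X = A ∘ₗ X ∘ₗ LinearMap.adjoint A := rfl

theorem ad_dyad (A : H →ₗ[ℂ] K) (x y : H) : ad A (dyad x y) = dyad (A x) (A y) := by
  rw [ad_apply, dyad_comp, comp_dyad, LinearMap.adjoint_adjoint]

theorem ad_comp (A : K →ₗ[ℂ] L) (B : H →ₗ[ℂ] K) : ad A ∘ₗ ad B = ad (A ∘ₗ B) := by
  ext1 X
  simp [ad_apply, LinearMap.adjoint_comp, LinearMap.comp_assoc]

theorem ad_map {K' L' : Type*} [NormedAddCommGroup K'] [InnerProductSpace ℂ K']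
    [FiniteDimensional ℂ K'] [NormedAddCommGroup L'] [InnerProductSpace ℂ L']
    [FiniteDimensional ℂ L'] (A : H →ₗ[ℂ] K) (B : K' →ₗ[ℂ] L') (X : Op H) (Y : Op K') :
    ad (TensorProduct.map A B) (TensorProduct.map X Y) = TensorProduct.map (ad A X) (ad B Y) := by
  simp [ad_apply, TensorProduct.map_comp, TensorProduct.adjoint_map]

theorem isPositive_ad (A : H →ₗ[ℂ] K) {X : Op H} (hX : X.IsPositive) : (ad A X).IsPositive :=
  hX.conj_adjoint A

theorem trace_ad_comm (A : H →ₗ[ℂ] K) (X : Op H) :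
    LinearMap.trace ℂ K (ad A X)
      = LinearMap.trace ℂ H ((LinearMap.adjoint A ∘ₗ A) ∘ₗ X) := by
  rw [ad_apply, LinearMap.trace_comp_comm', LinearMap.comp_assoc, LinearMap.trace_comp_comm']

theorem adjoint_comp_isometry (A : H →ₗᵢ[ℂ] K) :
    LinearMap.adjoint A.toLinearMap ∘ₗ A.toLinearMap = LinearMap.id := by
  ext x
  refine ext_inner_right ℂ fun y ↦ ?_
  simp

theorem trace_ad_isometry (A : H →ₗᵢ[ℂ] K) (X : Op H) :
    LinearMap.trace ℂ K (ad A.toLinearMap X) = LinearMap.trace ℂ H X := by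
  rw [trace_ad_comm, adjoint_comp_isometry, LinearMap.id_comp]

theorem ad_conj (U : H ≃ₗᵢ[ℂ] K) (X : Op H) :
    U.toLinearEquiv.conj X = ad U.toLinearIsometry.toLinearMap X := by
  ext1 y
  have h : LinearMap.adjoint U.toLinearIsometry.toLinearMap y = U.symm y := by
    refine ext_inner_right ℂ fun z ↦ ?_
    rw [LinearMap.adjoint_inner_left]
    simp [LinearIsometryEquiv.inner_map_eq_flip]
  simp [ad_apply, LinearEquiv.conj_apply, h]

theorem ad_adjoint_comp_ad (A : H →ₗᵢ[ℂ] K) (X : Op H) :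
    ad (LinearMap.adjoint A.toLinearMap) (ad A.toLinearMap X) = X := by
  rw [← LinearMap.comp_apply, ad_comp, adjoint_comp_isometry]
  ext; simp [ad_apply]

theorem ampl_ad (n : ℕ) (A : H →ₗ[ℂ] K) :
    ampl n (ad A) = ad (TensorProduct.map A LinearMap.id) := by
  refine op_tensor_ext fun X Y ↦ ?_
  rw [ampl_map, ad_map]
  simp [ad_apply]

theorem ampl_comp (n : ℕ) (S : SuperOp K L) (T : SuperOp H K) :
    ampl n (S ∘ₗ T) = ampl n S ∘ₗ ampl n T := by
  refine op_tensor_ext fun X Y ↦ ?_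
  simp [ampl_map]

theorem ampl_add (n : ℕ) (S T : SuperOp H K) : ampl n (S + T) = ampl n S + ampl n T := by
  refine op_tensor_ext fun X Y ↦ ?_
  simp [ampl_map, TensorProduct.map_add_left]

theorem ampl_smul (n : ℕ) (c : ℂ) (T : SuperOp H K) : ampl n (c • T) = c • ampl n T := by
  refine op_tensor_ext fun X Y ↦ ?_
  simp [ampl_map, TensorProduct.map_smul_left]

/-- Amplification, as a linear map. -/
def amplₗ (n : ℕ) : SuperOp H K →ₗ[ℂ] SuperOp (H ⊗[ℂ] Anc n) (K ⊗[ℂ] Anc n) where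
  toFun := ampl n
  map_add' := ampl_add n
  map_smul' := ampl_smul n

theorem ampl_sum (n : ℕ) {ι : Type*} (s : Finset ι) (T : ι → SuperOp H K) :
    ampl n (∑ i ∈ s, T i) = ∑ i ∈ s, ampl n (T i) :=
  map_sum (amplₗ n) T s

theorem IsCompletelyPositive.comp {S : SuperOp K L} {T : SuperOp H K}
    (hS : IsCompletelyPositive S) (hT : IsCompletelyPositive T) :
    IsCompletelyPositive (S ∘ₗ T) := fun n X hX ↦ by
  rw [ampl_comp]
  exact hS n _ (hT n _ hX)

theorem IsCompletelyPositive.add {S T : SuperOp H K}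
    (hS : IsCompletelyPositive S) (hT : IsCompletelyPositive T) :
    IsCompletelyPositive (S + T) := fun n X hX ↦ by
  rw [ampl_add]
  exact (hS n _ hX).add (hT n _ hX)

theorem IsCompletelyPositive.sum {ι : Type*} {s : Finset ι} {T : ι → SuperOp H K}
    (hT : ∀ i ∈ s, IsCompletelyPositive (T i)) : IsCompletelyPositive (∑ i ∈ s, T i) :=
  fun n X hX ↦ by
    rw [ampl_sum, LinearMap.sum_apply]
    exact LinearMap.isPositive_sum _ fun i hi ↦ hT i hi n X hX

theorem IsCompletelyPositive.smul {T : SuperOp H K} (hT : IsCompletelyPositive T) {c : ℂ}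
    (hc : 0 ≤ c) : IsCompletelyPositive (c • T) := fun n X hX ↦ by
  rw [ampl_smul]
  exact (hT n _ hX).smul_of_nonneg hc

theorem isCompletelyPositive_ad (A : H →ₗ[ℂ] K) : IsCompletelyPositive (ad A) := fun n X hX ↦ by
  rw [ampl_ad]
  exact isPositive_ad _ hX

theorem trace_ampl (n : ℕ) {T : SuperOp H K}
    (hT : ∀ X, LinearMap.trace ℂ K (T X) = LinearMap.trace ℂ H X) (X : Op (H ⊗[ℂ] Anc n)) :
    LinearMap.trace ℂ _ (ampl n T X) = LinearMap.trace ℂ _ X := by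
  have h : LinearMap.trace ℂ _ ∘ₗ ampl n T = LinearMap.trace ℂ _ := op_tensor_ext fun X Y ↦ by
    simp [ampl_map, LinearMap.trace_tensorProduct', hT]
  exact LinearMap.congr_fun h X

/-- Feeding the map `X ↦ t(X) τ` to a superchannel and tracing exposes `t ∘ tr_A` at the place where
the map is inserted. -/
theorem trace_ampl_functional (n : ℕ) (t : Op H →ₗ[ℂ] ℂ) {τ : Op K}
    (hτ : LinearMap.trace ℂ K τ = 1) (X : Op (H ⊗[ℂ] Anc n)) :
    LinearMap.trace ℂ _ (ampl n (t.smulRight τ) X) = t (ptrace n X) := by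
  have h : LinearMap.trace ℂ _ ∘ₗ ampl n (t.smulRight τ) = t ∘ₗ ptrace n :=
    op_tensor_ext fun X Y ↦ by
      simp [ampl_map, ptrace_map, LinearMap.trace_tensorProduct', hτ, mul_comm]
  exact LinearMap.congr_fun h X

/-- The standard basis vectors of the ancilla. -/
def ancVec {n : ℕ} (i : Fin n) : Anc n := EuclideanSpace.basisFun (Fin n) ℂ i

theorem inner_ancVec {n : ℕ} (i j : Fin n) :
    inner ℂ (ancVec i) (ancVec j) = if i = j then (1 : ℂ) else 0 :=
  orthonormal_iff_ite.1 (EuclideanSpace.basisFun (Fin n) ℂ).orthonormal i j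

theorem norm_ancVec {n : ℕ} (i : Fin n) : ‖ancVec i‖ = 1 :=
  (EuclideanSpace.basisFun (Fin n) ℂ).orthonormal.norm_eq_one i

/-- `ℂᵐ ⊗ ℂⁿ ≃ ℂᵐⁿ`. -/
def ancProd (m n : ℕ) : Anc m ⊗[ℂ] Anc n ≃ₗᵢ[ℂ] Anc (m * n) :=
  ((EuclideanSpace.basisFun (Fin m) ℂ).tensorProduct (EuclideanSpace.basisFun (Fin n) ℂ)).equiv
    (EuclideanSpace.basisFun (Fin (m * n)) ℂ) finProdFinEquiv

/-- `(H ⊗ ℂᵐ) ⊗ ℂⁿ ≃ H ⊗ ℂᵐⁿ`. -/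
def ancAssoc (H : Type*) [NormedAddCommGroup H] [InnerProductSpace ℂ H] (m n : ℕ) :
    (H ⊗[ℂ] Anc m) ⊗[ℂ] Anc n ≃ₗᵢ[ℂ] H ⊗[ℂ] Anc (m * n) :=
  (TensorProduct.assocIsometry ℂ H (Anc m) (Anc n)).trans
    (TensorProduct.congrIsometry (LinearIsometryEquiv.refl ℂ H) (ancProd m n))

omit [FiniteDimensional ℂ H] in
theorem ancAssoc_conj_map {m n : ℕ} (X : Op H) (Y : Op (Anc m)) (Z : Op (Anc n)) :
    (ancAssoc H m n).toLinearEquiv.conj (TensorProduct.map (TensorProduct.map X Y) Z)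
      = TensorProduct.map X ((ancProd m n).toLinearEquiv.conj (TensorProduct.map Y Z)) := by
  have h : (ancAssoc H m n).toLinearEquiv.toLinearMap ∘ₗ
        TensorProduct.map (TensorProduct.map X Y) Z
      = TensorProduct.map X ((ancProd m n).toLinearEquiv.conj (TensorProduct.map Y Z)) ∘ₗ
        (ancAssoc H m n).toLinearEquiv.toLinearMap := by
    refine TensorProduct.ext_threefold fun x y z ↦ ?_
    simp [ancAssoc, LinearEquiv.conj_apply]
  rw [LinearEquiv.conj_apply, h]
  refine LinearMap.ext fun x ↦ ?_
  exact congrArg _ ((ancAssoc H m n).apply_symm_apply x)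

/-- Two successive ancillas amount to one of the product dimension, so complete positivity survives
amplification. -/
theorem ampl_ampl (m n : ℕ) (T : SuperOp H K) (X : Op ((H ⊗[ℂ] Anc m) ⊗[ℂ] Anc n)) :
    (ancAssoc K m n).toLinearEquiv.conj (ampl n (ampl m T) X)
      = ampl (m * n) T ((ancAssoc H m n).toLinearEquiv.conj X) := by
  have h : (ancAssoc K m n).toLinearEquiv.conj.toLinearMap ∘ₗ ampl n (ampl m T)
      = ampl (m * n) T ∘ₗ (ancAssoc H m n).toLinearEquiv.conj.toLinearMap := by
    refine op_tensor_ext fun W Z ↦ ?_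
    have h' : (ancAssoc K m n).toLinearEquiv.conj.toLinearMap ∘ₗ ampl n (ampl m T) ∘ₗ
          (TensorProduct.mapBilinear (.id ℂ) (H ⊗[ℂ] Anc m) (Anc n)
            (H ⊗[ℂ] Anc m) (Anc n)).flip Z
        = ampl (m * n) T ∘ₗ (ancAssoc H m n).toLinearEquiv.conj.toLinearMap ∘ₗ
          (TensorProduct.mapBilinear (.id ℂ) (H ⊗[ℂ] Anc m) (Anc n)
            (H ⊗[ℂ] Anc m) (Anc n)).flip Z := by
      refine op_tensor_ext fun X Y ↦ ?_
      simp only [LinearMap.comp_apply, LinearMap.flip_apply, TensorProduct.mapBilinear_apply,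
        ampl_map, LinearEquiv.coe_coe, ancAssoc_conj_map]
    exact LinearMap.congr_fun h' W
  exact LinearMap.congr_fun h X

theorem IsCompletelyPositive.amplify {T : SuperOp H K} (hT : IsCompletelyPositive T) (m : ℕ) :
    IsCompletelyPositive (ampl m T) := fun n X hX ↦ by
  refine (LinearMap.isPositive_linearIsometryEquiv_conj_iff (ancAssoc K m n)).1 ?_
  have h := hT _ _ ((LinearMap.isPositive_linearIsometryEquiv_conj_iff (ancAssoc H m n)).2 hX)
  exact (congrArg LinearMap.IsPositive (ampl_ampl m n T X)).mpr h

theorem op_dyad_ext {M : Type*} [AddCommGroup M] [Module ℂ M] {f g : Op H →ₗ[ℂ] M}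
    (h : ∀ x y : H, f (dyad x y) = g (dyad x y)) : f = g := by
  ext X
  rw [sum_dyad_eq (stdOrthonormalBasis ℂ H) X, map_sum, map_sum]
  exact Finset.sum_congr rfl fun i _ ↦ h _ _

theorem ad_tmul {n : ℕ} (e : Anc n) (X : Op H) :
    ad ((TensorProduct.mk ℂ H (Anc n)).flip e) X = TensorProduct.map X (dyad e e) := by
  have h : ad ((TensorProduct.mk ℂ H (Anc n)).flip e)
      = (TensorProduct.mapBilinear (.id ℂ) H (Anc n) H (Anc n)).flip (dyad e e) :=
    op_dyad_ext fun x y ↦ by simp [ad_dyad, map_dyad]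
  exact LinearMap.congr_fun h X

/-- A one-dimensional ancilla turns complete positivity into positivity. -/
theorem IsCompletelyPositive.isPositive {T : SuperOp H K} (hT : IsCompletelyPositive T)
    {X : Op H} (hX : X.IsPositive) : (T X).IsPositive := by
  let e : Anc 1 := ancVec 0
  have h := hT 1 _ (isPositive_ad ((TensorProduct.mk ℂ H (Anc 1)).flip e) hX)
  rw [ad_tmul, ampl_map] at h
  rw [LinearMap.isPositive_iff]
  have key (x y : K) : inner ℂ (TensorProduct.map (T X) (dyad e e) (x ⊗ₜ[ℂ] e)) (y ⊗ₜ[ℂ] e)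
      = inner ℂ (T X x) y := by
    simp [dyad_apply, e, norm_ancVec]
  refine ⟨fun x y ↦ ?_, fun x ↦ ?_⟩
  · have h1 := h.isSymmetric (x ⊗ₜ[ℂ] e) (y ⊗ₜ[ℂ] e)
    rw [key] at h1
    rw [h1]
    simp [dyad_apply, e, norm_ancVec]
  · rw [← key]
    exact h.inner_nonneg_left _

theorem IsChannel.comp {S : SuperOp K L} {T : SuperOp H K} (hS : IsChannel S)
    (hT : IsChannel T) : IsChannel (S ∘ₗ T) :=
  ⟨hS.1.comp hT.1, fun X ↦ by rw [LinearMap.comp_apply, hS.2, hT.2]⟩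

theorem IsChannel.amplify {T : SuperOp H K} (hT : IsChannel T) (n : ℕ) : IsChannel (ampl n T) :=
  ⟨hT.1.amplify n, trace_ampl n hT.2⟩

theorem isChannel_ad (A : H →ₗᵢ[ℂ] K) : IsChannel (ad A.toLinearMap) :=
  ⟨isCompletelyPositive_ad _, trace_ad_isometry A⟩

theorem isChannel_convex_sum {N : ℕ} {p : Fin N → ℝ} (hp : ∀ k, 0 ≤ p k) (hp1 : ∑ k, p k = 1)
    {T : Fin N → SuperOp H K} (hT : ∀ k, IsChannel (T k)) :
    IsChannel (∑ k, (p k : ℂ) • T k) := by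
  refine ⟨.sum fun k _ ↦ (hT k).1.smul (by exact_mod_cast hp k), fun X ↦ ?_⟩
  simp [LinearMap.sum_apply, (hT _).2, ← Finset.sum_mul, ← Complex.ofReal_sum, hp1]

end Ampl

/-! ### Positive operators, coherences and recovery channels. -/

section

variable {H K L : Type*} [NormedAddCommGroup H] [InnerProductSpace ℂ H] [FiniteDimensional ℂ H]
  [NormedAddCommGroup K] [InnerProductSpace ℂ K] [FiniteDimensional ℂ K]
  [NormedAddCommGroup L] [InnerProductSpace ℂ L] [FiniteDimensional ℂ L]

theorem exists_eq_sum_dyad {X : Op H} (hX : X.IsPositive) :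
    ∃ (m : ℕ) (u : Fin m → H), X = ∑ i, dyad (u i) (u i) := by
  obtain ⟨m, u, h⟩ := ContinuousLinearMap.isPositive_iff_eq_sum_rankOne.1
    ((LinearMap.isPositive_toContinuousLinearMap_iff X).2 hX)
  refine ⟨m, u, ?_⟩
  ext z
  have := congrArg (fun f : H →L[ℂ] H ↦ f z) h
  simpa [dyad_apply] using this

/-- For `X = ∑ |u_i⟩⟨u_i|` the expectation in `z` is `∑ |⟨u_i, z⟩|²`, so it vanishes only if every
term does. -/
theorem apply_eq_zero_of_inner_eq_zero {X : Op H} (hX : X.IsPositive) {z : H}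
    (hz : inner ℂ z (X z) = 0) : X z = 0 := by
  obtain ⟨m, u, rfl⟩ := exists_eq_sum_dyad hX
  have h : ∑ i, ‖inner ℂ (u i) z‖ ^ 2 = 0 := by
    have h1 : (inner ℂ z ((∑ i, dyad (u i) (u i)) z) : ℂ)
        = ((∑ i, ‖inner ℂ (u i) z‖ ^ 2 : ℝ) : ℂ) := by
      simp only [LinearMap.sum_apply, dyad_apply, inner_sum, inner_smul_right]
      push_cast
      refine Finset.sum_congr rfl fun i _ ↦ ?_
      rw [← inner_conj_symm z (u i), RCLike.mul_conj]
      rfl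
    rw [h1] at hz
    exact_mod_cast hz
  rw [Finset.sum_eq_zero_iff_of_nonneg fun i _ ↦ by positivity] at h
  rw [LinearMap.sum_apply]
  refine Finset.sum_eq_zero fun i hi ↦ ?_
  have := h i hi
  simp only [ne_eq, OfNat.ofNat_ne_zero, not_false_eq_true, pow_eq_zero_iff, norm_eq_zero] at this
  rw [dyad_apply, this, zero_smul]

theorem eq_zero_of_trace_eq_zero {X : Op H} (hX : X.IsPositive)
    (h : LinearMap.trace ℂ H X = 0) : X = 0 := by
  have hb := LinearMap.trace_eq_sum_inner X (stdOrthonormalBasis ℂ H)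
  rw [h, eq_comm, Finset.sum_eq_zero_iff_of_nonneg fun i _ ↦ hX.inner_nonneg_right _] at hb
  refine (stdOrthonormalBasis ℂ H).toBasis.ext fun i ↦ ?_
  simpa using apply_eq_zero_of_inner_eq_zero hX (hb i (Finset.mem_univ i))

omit [FiniteDimensional ℂ H] [FiniteDimensional ℂ K] in
theorem eq_smul_dyad {x : K} {y : H} (hx : ‖x‖ = 1) (hy : ‖y‖ = 1) {A : H →ₗ[ℂ] K}
    (h1 : ∀ z, inner ℂ y z = 0 → A z = 0)
    (h2 : ∀ z a, inner ℂ x z = 0 → inner ℂ z (A a) = 0) :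
    A = inner ℂ x (A y) • dyad x y := by
  have hAy : A y = inner ℂ x (A y) • x := by
    have hz : inner ℂ x (A y - inner ℂ x (A y) • x) = 0 := by
      simp [hx]
    rw [← sub_eq_zero, ← inner_self_eq_zero (𝕜 := ℂ)]
    conv_lhs => rw [inner_sub_right]
    rw [h2 _ _ hz, inner_smul_right, inner_eq_zero_symm.1 hz]
    simp
  ext a
  have ha : A (a - inner ℂ y a • y) = 0 := h1 _ (by
    simp [hy])
  rw [map_sub, map_smul, sub_eq_zero] at ha
  rw [ha]
  conv_lhs => rw [hAy]
  simp [dyad_apply, smul_smul, mul_comm]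

theorem adjoint_id_sub_dyad (u : H) :
    LinearMap.adjoint (LinearMap.id - dyad u u) = LinearMap.id - dyad u u := by
  simp [map_sub, adjoint_dyad]

theorem trace_ad_id_sub_dyad {u : H} (hu : ‖u‖ = 1) (X : Op H) :
    LinearMap.trace ℂ H (ad (LinearMap.id - dyad u u) X)
      = LinearMap.trace ℂ H X - inner ℂ u (X u) := by
  have hMM : (LinearMap.id - dyad u u) ∘ₗ (LinearMap.id - dyad u u) = LinearMap.id - dyad u u := by
    ext z
    simp [dyad_apply, hu]
  rw [trace_ad_comm, adjoint_id_sub_dyad, hMM, LinearMap.sub_comp, LinearMap.id_comp, map_sub,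
    dyad_comp, trace_dyad, LinearMap.adjoint_inner_left]

theorem inner_le_trace {X : Op H} (hX : X.IsPositive) {u : H} (hu : ‖u‖ = 1) :
    inner ℂ u (X u) ≤ LinearMap.trace ℂ H X := by
  rw [← sub_nonneg, ← trace_ad_id_sub_dyad hu]
  exact (isPositive_ad _ hX).trace_nonneg

/-- The compression of `X` to the complement of `u` is positive with trace `1 - 1 = 0`, so `X`
annihilates that complement. -/
theorem eq_dyad_self_of_inner_eq_one {X : Op H} (hX : X.IsPositive)
    (ht : LinearMap.trace ℂ H X = 1) {u : H} (hu : ‖u‖ = 1) (h : inner ℂ u (X u) = 1) :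
    X = dyad u u := by
  have h0 : ad (LinearMap.id - dyad u u) X = 0 :=
    eq_zero_of_trace_eq_zero (isPositive_ad _ hX) (by
      rw [trace_ad_id_sub_dyad hu, ht, h, sub_self])
  have h1 : ∀ z, inner ℂ u z = 0 → X z = 0 := fun z hz ↦ by
    refine apply_eq_zero_of_inner_eq_zero hX ?_
    have hMz : (LinearMap.id - dyad u u : Op H) z = z := by simp [dyad_apply, hz]
    have := congrArg (fun f : Op H ↦ (inner ℂ z (f z) : ℂ)) h0
    simp only [ad_apply, adjoint_id_sub_dyad, LinearMap.comp_apply, hMz] at this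
    rw [← LinearMap.adjoint_inner_left, adjoint_id_sub_dyad, hMz] at this
    simpa using this
  rw [eq_smul_dyad hu hu h1, h, one_smul]
  intro z a hz
  rw [← hX.isSymmetric z a, h1 z hz, inner_zero_left]

/-- A completely positive trace-preserving map that acts on two non-orthogonal pure states as an
isometry also acts as that isometry on the coherence between them. -/
theorem IsChannel.apply_dyad {S : SuperOp H K} (hS : IsChannel S) {x y : H} {x' y' : K}
    (hx' : ‖x'‖ = 1) (hy' : ‖y'‖ = 1) (hxx : S (dyad x x) = dyad x' x')
    (hyy : S (dyad y y) = dyad y' y') (hxy : inner ℂ y' x' = inner ℂ y x)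
    (h0 : inner ℂ y x ≠ 0) : S (dyad x y) = dyad x' y' := by
  let e : Fin 2 → Anc 2 := ancVec
  -- `Y` is a positive 2×2 block operator with diagonal blocks `|x'⟩⟨x'|` and `|y'⟩⟨y'|`. Their
  -- kernels force the off-diagonal block `S |x⟩⟨y|` to be a multiple of `|x'⟩⟨y'|`; trace
  -- preservation fixes the factor, because `⟨y, x⟩ ≠ 0`.
  set Y : Op (K ⊗[ℂ] Anc 2) := ampl 2 S (dyad (x ⊗ₜ e 0 + y ⊗ₜ e 1) (x ⊗ₜ e 0 + y ⊗ₜ e 1))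
    with hY
  have hYpos : Y.IsPositive := hS.1 2 _ (isPositive_dyad_self _)
  have hYeq : Y = TensorProduct.map (dyad x' x') (dyad (e 0) (e 0))
      + TensorProduct.map (S (dyad x y)) (dyad (e 0) (e 1))
      + TensorProduct.map (S (dyad y x)) (dyad (e 1) (e 0))
      + TensorProduct.map (dyad y' y') (dyad (e 1) (e 1)) := by
    rw [hY, ← hxx, ← hyy, ← ampl_map, ← ampl_map, ← ampl_map, ← ampl_map]
    simp only [dyad_add_left, dyad_add_right, map_add, map_dyad]
    abel
  have e00 : ‖e 0‖ = 1 := norm_ancVec _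
  have e11 : ‖e 1‖ = 1 := norm_ancVec _
  have e01 : inner ℂ (e 0) (e 1) = (0 : ℂ) := by simp [e, inner_ancVec]
  have e10 : inner ℂ (e 1) (e 0) = (0 : ℂ) := by simp [e, inner_ancVec]
  have hY0 (z : K) : Y (z ⊗ₜ e 0) = inner ℂ x' z • x' ⊗ₜ e 0 + S (dyad y x) z ⊗ₜ e 1 := by
    simp [hYeq, dyad_apply, e00, e10, TensorProduct.smul_tmul']
  have hY1 (z : K) : Y (z ⊗ₜ e 1) = S (dyad x y) z ⊗ₜ e 0 + inner ℂ y' z • y' ⊗ₜ e 1 := by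
    simp [hYeq, dyad_apply, e11, e01, TensorProduct.smul_tmul']
  have h1 (z : K) (hz : inner ℂ y' z = 0) : S (dyad x y) z = 0 := by
    have h : Y (z ⊗ₜ e 1) = 0 := apply_eq_zero_of_inner_eq_zero hYpos (by
      rw [hY1, hz]; simp [e10])
    rw [hY1, hz] at h
    have h' := congrArg (fun t ↦ (inner ℂ (S (dyad x y) z ⊗ₜ[ℂ] e 0) t : ℂ)) h
    simpa [e00, ← norm_eq_zero (a := e 0)] using h'
  have h2 (z a : K) (hz : inner ℂ x' z = 0) : inner ℂ z (S (dyad x y) a) = 0 := by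
    have h : Y (z ⊗ₜ e 0) = 0 := apply_eq_zero_of_inner_eq_zero hYpos (by
      rw [hY0, hz]; simp [e01])
    have h' := hYpos.isSymmetric (z ⊗ₜ e 0) (a ⊗ₜ e 1)
    rw [h, hY1] at h'
    simpa [inner_add_right, TensorProduct.smul_tmul', e00, e01] using h'.symm
  have hc := eq_smul_dyad hx' hy' h1 h2
  have ht := hS.2 (dyad x y)
  rw [hc, map_smul, trace_dyad, trace_dyad, smul_eq_mul, hxy] at ht
  rw [hc, mul_eq_right₀ h0 |>.1 ht, one_smul]

/-- The map which undoes `X ↦ A X A†`, transports the result along `B`, and replaces what is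
orthogonal to the range of `A` by the pure state `|w⟩⟨w|`. -/
def recovery (A : K →ₗᵢ[ℂ] H) (B : K →ₗᵢ[ℂ] L) (w : L) : SuperOp H L :=
  ad (B.toLinearMap ∘ₗ LinearMap.adjoint A.toLinearMap) +
    (LinearMap.trace ℂ H - LinearMap.trace ℂ K ∘ₗ ad (LinearMap.adjoint A.toLinearMap)).smulRight
      (dyad w w)

theorem recovery_apply (A : K →ₗᵢ[ℂ] H) (B : K →ₗᵢ[ℂ] L) (w : L) (Y : Op H) :
    recovery A B w Y = ad B.toLinearMap (ad (LinearMap.adjoint A.toLinearMap) Y) +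
      (LinearMap.trace ℂ H Y - LinearMap.trace ℂ K (ad (LinearMap.adjoint A.toLinearMap) Y)) •
        dyad w w := by
  rw [recovery, ← ad_comp]
  simp

theorem recovery_ad (A : K →ₗᵢ[ℂ] H) (B : K →ₗᵢ[ℂ] L) (w : L) (X : Op K) :
    recovery A B w (ad A.toLinearMap X) = ad B.toLinearMap X := by
  rw [recovery_apply, ad_adjoint_comp_ad, trace_ad_isometry]
  simp

theorem isChannel_recovery (A : K →ₗᵢ[ℂ] H) (B : K →ₗᵢ[ℂ] L) {w : L} (hw : ‖w‖ = 1) :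
    IsChannel (recovery A B w) := by
  refine ⟨(isCompletelyPositive_ad _).add ?_, fun X ↦ ?_⟩
  · let M : Op H := LinearMap.id - A.toLinearMap ∘ₗ LinearMap.adjoint A.toLinearMap
    have h (a b : H) : inner ℂ a (A.toLinearMap (LinearMap.adjoint A.toLinearMap b))
        = inner ℂ (LinearMap.adjoint A.toLinearMap a) (LinearMap.adjoint A.toLinearMap b) :=
      (LinearMap.adjoint_inner_left _ _ _).symm
    have h' (a b : H) : inner ℂ (A.toLinearMap (LinearMap.adjoint A.toLinearMap a)) b
        = inner ℂ (LinearMap.adjoint A.toLinearMap a) (LinearMap.adjoint A.toLinearMap b) :=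
      (LinearMap.adjoint_inner_right _ _ _).symm
    have h'' (a b : K) : inner ℂ (A.toLinearMap a) (A.toLinearMap b) = inner ℂ a b :=
      A.inner_map_map a b
    have hM (x y : H) : inner ℂ (M x) y = inner ℂ x (M y) := by
      simp only [M, LinearMap.sub_apply, LinearMap.id_apply, LinearMap.comp_apply, inner_sub_left,
        inner_sub_right, h, h']
    have hMM (x y : H) : inner ℂ (M y) (M x) = inner ℂ y x - inner ℂ
        (LinearMap.adjoint A.toLinearMap y) (LinearMap.adjoint A.toLinearMap x) := by
      simp only [M, LinearMap.sub_apply, LinearMap.id_apply, LinearMap.comp_apply, inner_sub_left,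
        inner_sub_right, h'']
      rw [h, h']
      ring
    let b := stdOrthonormalBasis ℂ H
    -- With `M = 1 - A A†`, the projection onto the complement of the range of `A`, the operators
    -- `|w⟩⟨M b_i|` are Kraus operators of the replacement term.
    have : (LinearMap.trace ℂ H - LinearMap.trace ℂ K ∘ₗ
        ad (LinearMap.adjoint A.toLinearMap)).smulRight (dyad w w)
        = ∑ i, ad (dyad w (M (b i))) := by
      refine op_dyad_ext fun x y ↦ ?_
      simp only [LinearMap.smulRight_apply, LinearMap.sub_apply, LinearMap.comp_apply, ad_dyad,
        trace_dyad, LinearMap.sum_apply, ← hMM]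
      rw [← b.sum_inner_mul_inner]
      simp only [dyad_apply, dyad_smul_left, dyad_smul_right, hM, smul_smul, ← Finset.sum_smul,
        inner_conj_symm]
    rw [this]
    exact .sum fun i _ ↦ isCompletelyPositive_ad _
  · rw [recovery_apply, map_add, trace_ad_isometry, map_smul, trace_dyad]
    simp [hw]

end

/-! ### Twirling unitaries and test vectors. -/

section

variable {H : Type*} [NormedAddCommGroup H] [InnerProductSpace ℂ H] [FiniteDimensional ℂ H]

/-- A complex Householder transformation moves one unit vector of `F` to another and fixes `Fᗮ`. -/
theorem exists_unitary_apply_eq {F : Submodule ℂ H} {x y : H} (hxF : x ∈ F) (hyF : y ∈ F)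
    (hx : ‖x‖ = 1) (hy : ‖y‖ = 1) :
    ∃ U : H ≃ₗᵢ[ℂ] H, U x = y ∧ ∀ z ∈ Fᗮ, U z = z := by
  by_cases hxy : x = y
  · exact ⟨LinearIsometryEquiv.refl ℂ H, by simp [hxy], by simp⟩
  set w := x - y with hw
  have hw0 : w ≠ 0 := sub_ne_zero.2 hxy
  have hxx : inner ℂ x x = (1 : ℂ) := by simp [inner_self_eq_norm_sq_to_K, hx]
  have hyy : inner ℂ y y = (1 : ℂ) := by simp [inner_self_eq_norm_sq_to_K, hy]
  have hww : inner ℂ w w = (inner ℂ w x + inner ℂ x w : ℂ) := by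
    simp only [hw, inner_sub_left, inner_sub_right, hxx, hyy]
    ring
  have hwx : inner ℂ w x ≠ (0 : ℂ) := fun h ↦ hw0 <| by
    rw [← inner_self_eq_zero (𝕜 := ℂ), hww, h, inner_eq_zero_symm.1 h, add_zero]
  have hxw : inner ℂ x w ≠ (0 : ℂ) := fun h ↦ hwx (inner_eq_zero_symm.1 h)
  -- The factor is chosen so that `x ↦ x - w = y`. As `⟨x, y⟩` need not be real, it may be complex;
  -- isometry then rests on `⟨w, w⟩ = ⟨w, x⟩ + ⟨x, w⟩`.
  let U₀ : H →ₗ[ℂ] H := LinearMap.id - (inner ℂ w x)⁻¹ • dyad w w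
  have hU (z : H) : U₀ z = z - ((inner ℂ w x)⁻¹ * inner ℂ w z) • w := by
    simp [U₀, dyad_apply, smul_smul]
  have hiso (a b : H) : inner ℂ (U₀ a) (U₀ b) = inner ℂ a b := by
    simp only [hU, inner_sub_left, inner_sub_right, inner_smul_left, inner_smul_right, map_mul,
      map_inv₀, inner_conj_symm, hww]
    field_simp
    ring
  let U := (U₀.isometryOfInner hiso).toLinearIsometryEquiv rfl
  refine ⟨U, ?_, fun z hz ↦ ?_⟩
  · change U₀ x = y
    rw [hU, inv_mul_cancel₀ hwx, one_smul, hw]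
    abel
  · change U₀ z = z
    rw [hU, hz w (F.sub_mem hxF hyF)]
    simp

omit [FiniteDimensional ℂ H] in
/-- A positive functional that vanishes on `|v⟩⟨v|` does not see any coherence with `v`. -/
theorem functional_dyad_add {t : Op H →ₗ[ℂ] ℂ} (ht : ∀ X : Op H, X.IsPositive → 0 ≤ t X) {v : H}
    (hv : t (dyad v v) = 0) (x : H) : t (dyad (v + x) (v + x)) = t (dyad x x) := by
  -- Rescaling `v` leaves no quadratic term, so the value is affine in `r`. Nonnegativity for all
  -- real `r` makes the real part of the slope zero, and reality of the values does the same for the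
  -- imaginary part.
  have key (r : ℝ) : t (dyad ((r : ℂ) • v + x) ((r : ℂ) • v + x))
      = r * (t (dyad v x) + t (dyad x v)) + t (dyad x x) := by
    simp only [dyad_add_left, dyad_add_right, dyad_smul_left, dyad_smul_right, map_add, map_smul,
      hv, smul_eq_mul, Complex.conj_ofReal]
    ring
  have hpos (r : ℝ) := key r ▸ ht _ (isPositive_dyad_self ((r : ℂ) • v + x))
  have hx := ht _ (isPositive_dyad_self x)
  set c := t (dyad v x) + t (dyad x v)
  set D := t (dyad x x)
  have hc : c = 0 := by
    simp only [Complex.nonneg_iff, Complex.add_re, Complex.add_im, Complex.re_ofReal_mul,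
      Complex.im_ofReal_mul] at hpos hx
    refine Complex.ext ?_ ?_
    · by_contra h
      have h1 := (hpos (-(D.re + 1) / c.re)).1
      rw [div_mul_cancel₀ _ h] at h1
      linarith
    · have h1 := (hpos 1).2
      rw [← hx.2, one_mul] at h1
      simpa using h1.symm
  have h1 := key 1
  rw [hc] at h1
  simpa using h1

theorem finrank_inf_orthogonal {V : Submodule ℂ H} {v : H} (hvV : v ∈ V) (hv : v ≠ 0) :
    Module.finrank ℂ (V ⊓ (ℂ ∙ v)ᗮ : Submodule ℂ H) + 1 = Module.finrank ℂ V := by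
  have h := Submodule.finrank_add_inf_finrank_orthogonal
    ((Submodule.span_singleton_le_iff_mem v V).2 hvV)
  rw [finrank_span_singleton hv, inf_comm] at h
  omega

/-- The properties of the twirl: the vectors `U_k⁻¹ χ` are pairwise non-orthogonal, span `V`, and
their average is seen by a positive functional that vanishes on `|v⟩⟨v|` as half of the maximally
mixed state on the orthogonal complement of `v` in `V`. -/
structure IsTwirl (V : Submodule ℂ H) (v χ : H) {N : ℕ} (U : Fin N → H ≃ₗᵢ[ℂ] H) : Prop where
  pos : 0 < N
  fix (k : Fin N) : U k v = v
  fix_orthogonal (k : Fin N) : ∀ x ∈ Vᗮ, U k x = x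
  norm_eq_one : ‖χ‖ = 1
  mem (k : Fin N) : (U k).symm χ ∈ V
  inner_ne_zero (k l : Fin N) : inner ℂ ((U k).symm χ) ((U l).symm χ) ≠ (0 : ℂ)
  le_span : V ≤ Submodule.span ℂ (Set.range fun k ↦ (U k).symm χ)
  average (t : Op H →ₗ[ℂ] ℂ) (ht : ∀ X : Op H, X.IsPositive → 0 ≤ t X) (hv : t (dyad v v) = 0) :
    ∑ k, ((N : ℂ)⁻¹) * t (dyad ((U k).symm χ) ((U k).symm χ)) =
      if 1 < Module.finrank ℂ V then
        (1 / 2 : ℂ) * t ((1 / ((Module.finrank ℂ V : ℂ) - 1)) •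
          (V ⊓ (ℂ ∙ v)ᗮ).starProjection.toLinearMap)
      else 0

theorem exists_isTwirl {V : Submodule ℂ H} {v : H} (hvV : v ∈ V) (hv : ‖v‖ = 1) :
    ∃ (χ : H) (N : ℕ) (U : Fin N → H ≃ₗᵢ[ℂ] H), IsTwirl V v χ U := by
  have hv0 : v ≠ 0 := fun h ↦ by simp [h] at hv
  have hvv : inner ℂ v v = (1 : ℂ) := by simp [inner_self_eq_norm_sq_to_K, hv]
  have hd := finrank_inf_orthogonal hvV hv0
  set F := V ⊓ (ℂ ∙ v)ᗮ with hF
  by_cases h1 : 1 < Module.finrank ℂ V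
  swap
  -- If `V` is the line through `v`, then `v` itself is a sufficient test vector and no twirling is
  -- needed.
  · refine ⟨v, 1, fun _ ↦ LinearIsometryEquiv.refl ℂ H, by simp, by simp, by simp, hv,
      fun _ ↦ hvV, by simp [hv], ?_, fun t ht hvt ↦ ?_⟩
    swap
    · simp only [if_neg h1, Finset.univ_unique, Finset.sum_const, Finset.card_singleton, one_smul]
      exact mul_eq_zero_of_right _ hvt
    have hVe : (ℂ ∙ v) = V := Submodule.eq_of_le_of_finrank_le
      ((Submodule.span_singleton_le_iff_mem v V).2 hvV) (by rw [finrank_span_singleton hv0]; omega)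
    exact hVe.ge.trans (Submodule.span_mono (Set.singleton_subset_iff.2 ⟨0, rfl⟩))
  set m := Module.finrank ℂ F with hm
  have hm0 : 0 < m := by omega
  let b : OrthonormalBasis (Fin m) ℂ F := stdOrthonormalBasis ℂ F
  -- The vectors `v + b_j` alone are one too few to span `V`, hence a second phase. The phase `-1`
  -- would make `v + b_j` and `v - b_j` orthogonal; with `I` the inner products stay nonzero.
  let ω : Fin 2 → ℂ := ![1, Complex.I]
  have hω (i : Fin 2) : ‖ω i‖ = 1 := by fin_cases i <;> simp [ω]
  let ψ : Fin m × Fin 2 → H := fun k ↦ ω k.2 • (b k.1 : H)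
  have hb (i j : Fin m) : inner ℂ (b i : H) (b j : H) = if i = j then (1 : ℂ) else 0 := by
    rw [← Submodule.coe_inner]
    exact orthonormal_iff_ite.1 b.orthonormal i j
  have hψF (k) : ψ k ∈ F := F.smul_mem _ (b k.1).2
  have hψ (k) : ‖ψ k‖ = 1 := by
    rw [norm_smul, hω, one_mul]
    exact b.orthonormal.norm_eq_one k.1
  have hvψ (k) : inner ℂ v (ψ k) = (0 : ℂ) :=
    Submodule.mem_orthogonal_singleton_iff_inner_right.1 (hψF k).2
  have hψv (k) : inner ℂ (ψ k) v = (0 : ℂ) := inner_eq_zero_symm.1 (hvψ k)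
  let k₀ : Fin m × Fin 2 := (⟨0, hm0⟩, 0)
  choose U hU hUfix using fun k ↦ exists_unitary_apply_eq (hψF k) (hψF k₀) (hψ k) (hψ k₀)
  have hUv (k) : U k v = v := hUfix k v fun z hz ↦
    Submodule.mem_orthogonal_singleton_iff_inner_left.1 hz.2
  -- Equal weight on `v` and `ψ`; its square is the `½` of the transformed functional.
  let s : ℂ := ((√2)⁻¹ : ℝ)
  have hss : s * s = 1 / 2 := by
    simp only [s, ← Complex.ofReal_mul, ← mul_inv, Real.mul_self_sqrt zero_le_two]
    norm_num
  have hsc : (starRingEnd ℂ) s = s := Complex.conj_ofReal _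
  have hs0 : s ≠ 0 := fun h ↦ by simp [h] at hss
  let x : Fin m × Fin 2 → H := fun k ↦ s • (v + ψ k)
  have hx (k) : (U k).symm (x k₀) = x k := by
    rw [LinearIsometryEquiv.symm_apply_eq]
    simp [x, hUv, hU]
  have hxV (k) : x k ∈ V := V.smul_mem _ (V.add_mem hvV (hψF k).1)
  have hxx (k l) : inner ℂ (x k) (x l) = (1 / 2 : ℂ) * (1 + inner ℂ (ψ k) (ψ l)) := by
    simp only [x, inner_smul_left, inner_smul_right, inner_add_left, inner_add_right, hsc, hvv,
      hvψ, hψv, ← hss]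
    ring
  let e : Fin (m * 2) ≃ Fin m × Fin 2 := finProdFinEquiv.symm
  refine ⟨x k₀, m * 2, fun k ↦ U (e k), by omega, fun k ↦ hUv _, fun k z hz ↦
    hUfix _ z (Submodule.orthogonal_le inf_le_left hz), ?_, fun k ↦ by rw [hx]; exact hxV _, fun k l ↦ ?_,
    ?_, fun t ht hvt ↦ ?_⟩
  · have h := hxx k₀ k₀
    rw [inner_self_eq_norm_sq_to_K, inner_self_eq_norm_sq_to_K, hψ] at h
    have h' : ((‖x k₀‖ ^ 2 : ℝ) : ℂ) = ((1 : ℝ) : ℂ) := by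
      push_cast
      refine h.trans ?_
      norm_num
    exact (pow_eq_one_iff_of_nonneg (norm_nonneg _) two_ne_zero).1 (Complex.ofReal_injective h')
  · rw [hx, hx, hxx]
    refine mul_ne_zero (by norm_num) ?_
    simp only [ψ, inner_smul_left, inner_smul_right, hb]
    split_ifs
    · generalize (e k).2 = i
      generalize (e l).2 = j
      intro h
      have h' := congrArg Complex.re h
      fin_cases i <;> fin_cases j <;> simp [ω] at h'
    · simp
  · simp only [hx]
    set S := Submodule.span ℂ (Set.range fun k ↦ x (e k)) with hS
    have hxS (k) : x k ∈ S := Submodule.subset_span ⟨e.symm k, by simp⟩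
    have hbS (j : Fin m) : (b j : H) ∈ S := by
      have h := S.sub_mem (hxS (j, 1)) (hxS (j, 0))
      have h2 : x (j, 1) - x (j, 0) = (s * (Complex.I - 1)) • (b j : H) := by
        simp only [x, ψ, ω, Matrix.cons_val_zero, Matrix.cons_val_one]
        module
      rw [h2] at h
      refine (S.smul_mem_iff (mul_ne_zero hs0 fun h ↦ ?_)).1 h
      simpa using congrArg Complex.re h
    have hFS : F ≤ S := fun z hz ↦ by
      have h := congrArg (Subtype.val) (b.sum_repr' ⟨z, hz⟩)
      simp only [Submodule.coe_sum, Submodule.coe_smul] at h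
      rw [← h]
      exact S.sum_mem fun j _ ↦ S.smul_mem _ (hbS j)
    have hvS : v ∈ S := by
      have h := (S.smul_mem_iff hs0).1 (hxS k₀)
      simpa using S.sub_mem h (hFS (hψF k₀))
    intro z hz
    have h : z - inner ℂ v z • v ∈ F := ⟨V.sub_mem hz (V.smul_mem _ hvV),
      Submodule.mem_orthogonal_singleton_iff_inner_right.2 (by
        rw [inner_sub_right, inner_smul_right, hvv]; ring)⟩
    simpa using S.add_mem (hFS h) (S.smul_mem (inner ℂ v z) hvS)
  · simp only [hx, if_pos h1, ← hF]
    have h (k) : t (dyad (x k) (x k)) = 1 / 2 * t (dyad (b k.1 : H) (b k.1 : H)) := by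
      simp only [x, dyad_smul_left, dyad_smul_right, map_smul, functional_dyad_add ht hvt, hsc,
        smul_eq_mul, ψ, ← mul_assoc, hss]
      rw [mul_assoc (1 / 2 : ℂ), RCLike.conj_mul, hω]
      simp
    have hP : F.starProjection.toLinearMap = ∑ j, dyad (b j : H) (b j : H) := by
      rw [b.starProjection_eq_sum_rankOne]
      ext z
      simp [dyad_apply]
    rw [← Finset.mul_sum, e.sum_comp fun k ↦ t (dyad (x k) (x k))]
    simp only [h, Fintype.sum_prod_type, hP, map_smul, map_sum, ← hd]
    have : (m : ℂ) ≠ 0 := by exact_mod_cast hm0.ne'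
    simp only [Finset.sum_const, Finset.card_univ, Fintype.card_fin, ← Finset.smul_sum,
      ← Finset.mul_sum]
    push_cast
    simp
    field_simp

end

/-! ### The twirl as a superchannel. -/

section

variable {H Q : Type*} [NormedAddCommGroup H] [InnerProductSpace ℂ H] [FiniteDimensional ℂ H]
  [NormedAddCommGroup Q] [InnerProductSpace ℂ Q] [FiniteDimensional ℂ Q]

theorem conj_dyad (U : H ≃ₗᵢ[ℂ] H) (x y : H) :
    U.toLinearEquiv.conj (dyad x y) = dyad (U x) (U y) := by
  rw [ad_conj, ad_dyad]
  rfl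

omit [FiniteDimensional ℂ H] in
theorem inner_conj_apply (U : H ≃ₗᵢ[ℂ] H) (Z : Op H) (x y : H) :
    inner ℂ x (U.toLinearEquiv.conj Z y) = inner ℂ (U.symm x) (Z (U.symm y)) := by
  rw [LinearEquiv.conj_apply]
  exact (LinearIsometryEquiv.inner_map_eq_flip U.symm x _).symm

theorem conj_eq_ad (U : H ≃ₗᵢ[ℂ] H) :
    U.toLinearEquiv.conj.toLinearMap = ad U.toLinearIsometry.toLinearMap :=
  LinearMap.ext (ad_conj U)

theorem isChannel_conj (U : H ≃ₗᵢ[ℂ] H) : IsChannel U.toLinearEquiv.conj.toLinearMap :=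
  conj_eq_ad U ▸ isChannel_ad _

/-- The average of `D ((Û_k C T Û_k⁻¹) ⊗ id) E` with weights `p k`. -/
def twirl (E : SuperOp Q (H ⊗[ℂ] Anc 2)) (C : SuperOp H H) (D : SuperOp (H ⊗[ℂ] Anc 2) Q)
    {N : ℕ} (p : Fin N → ℝ) (U : Fin N → H ≃ₗᵢ[ℂ] H) : SuperOp H H →ₗ[ℂ] SuperOp Q Q where
  toFun T := ∑ k, (p k : ℂ) •
      (D ∘ₗ ampl 2 ((U k).toLinearEquiv.conj.toLinearMap ∘ₗ C ∘ₗ T ∘ₗ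
        (U k).symm.toLinearEquiv.conj.toLinearMap) ∘ₗ E)
  map_add' S T := by
    simp only [LinearMap.add_comp, LinearMap.comp_add, ampl_add, smul_add, Finset.sum_add_distrib]
  map_smul' c T := by
    simp only [LinearMap.smul_comp, LinearMap.comp_smul, ampl_smul, Finset.smul_sum,
      RingHom.id_apply]
    exact Finset.sum_congr rfl fun k _ ↦ smul_comm _ _ _

omit [FiniteDimensional ℂ Q] in
theorem twirl_apply (E : SuperOp Q (H ⊗[ℂ] Anc 2)) (C : SuperOp H H)
    (D : SuperOp (H ⊗[ℂ] Anc 2) Q) {N : ℕ} (p : Fin N → ℝ) (U : Fin N → H ≃ₗᵢ[ℂ] H)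
    (T : SuperOp H H) : twirl E C D p U T = ∑ k, (p k : ℂ) •
      (D ∘ₗ ampl 2 ((U k).toLinearEquiv.conj.toLinearMap ∘ₗ C ∘ₗ T ∘ₗ
        (U k).symm.toLinearEquiv.conj.toLinearMap) ∘ₗ E) := rfl

section Register

variable (N m : ℕ)

/-- The isometry that writes `k` into a classical register. -/
def registerIsometry (k : Fin N) : Anc m →ₗᵢ[ℂ] Anc (N * m) :=
  LinearMap.isometryOfOrthonormal
    ((EuclideanSpace.basisFun (Fin m) ℂ).toBasis.constr ℂ fun i ↦ ancVec (finProdFinEquiv (k, i)))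
    (v := (EuclideanSpace.basisFun (Fin m) ℂ).toBasis)
    (by simp)
    (by
      rw [orthonormal_iff_ite]
      intro i j
      simp only [Function.comp_apply, Module.Basis.constr_basis, inner_ancVec]
      simp)

variable {N m}

theorem registerIsometry_ancVec (k : Fin N) (i : Fin m) :
    registerIsometry N m k (ancVec i) = ancVec (finProdFinEquiv (k, i)) := by
  have h := (EuclideanSpace.basisFun (Fin m) ℂ).toBasis.constr_basis ℂ
    (fun i ↦ (ancVec (finProdFinEquiv (k, i)) : Anc (N * m))) i
  rwa [OrthonormalBasis.coe_toBasis] at h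

theorem adjoint_registerIsometry (k l : Fin N) (i : Fin m) :
    LinearMap.adjoint (registerIsometry N m k).toLinearMap (ancVec (finProdFinEquiv (l, i)))
      = if k = l then ancVec i else 0 := by
  refine InnerProductSpace.ext_inner_right_basis
    (EuclideanSpace.basisFun (Fin m) ℂ).toBasis fun j ↦ ?_
  rw [OrthonormalBasis.coe_toBasis]
  change inner ℂ _ (ancVec j) = inner ℂ _ (ancVec j)
  rw [LinearMap.adjoint_inner_left, LinearIsometry.coe_toLinearMap, registerIsometry_ancVec,
    inner_ancVec]
  by_cases h : k = l
  · simp [h, inner_ancVec]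
  · simp [h, Ne.symm h]

theorem adjoint_comp_registerIsometry (k l : Fin N) :
    LinearMap.adjoint (registerIsometry N m k).toLinearMap ∘ₗ
      (registerIsometry N m l).toLinearMap = if k = l then LinearMap.id else 0 := by
  refine (EuclideanSpace.basisFun (Fin m) ℂ).toBasis.ext fun i ↦ ?_
  rw [OrthonormalBasis.coe_toBasis]
  change LinearMap.adjoint (registerIsometry N m k).toLinearMap
    (registerIsometry N m l (ancVec i)) = (if k = l then LinearMap.id else 0 : Op _) (ancVec i)
  rw [registerIsometry_ancVec, adjoint_registerIsometry]
  split_ifs <;> simp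

theorem sum_registerIsometry_comp_adjoint :
    ∑ k, (registerIsometry N m k).toLinearMap ∘ₗ
      LinearMap.adjoint (registerIsometry N m k).toLinearMap = LinearMap.id := by
  refine (EuclideanSpace.basisFun (Fin (N * m)) ℂ).toBasis.ext fun i ↦ ?_
  obtain ⟨⟨l, i⟩, rfl⟩ := finProdFinEquiv.surjective i
  rw [OrthonormalBasis.coe_toBasis]
  change (∑ k, (registerIsometry N m k).toLinearMap ∘ₗ
      LinearMap.adjoint (registerIsometry N m k).toLinearMap) (ancVec (finProdFinEquiv (l, i)))
    = ancVec (finProdFinEquiv (l, i))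
  simp only [LinearMap.sum_apply, LinearMap.comp_apply, adjoint_registerIsometry]
  rw [Finset.sum_eq_single l]
  · simp [registerIsometry_ancVec]
  · intro k _ hk
    simp [hk]
  · simp

/-- `T` does not touch the register, so reading `k` after writing `l` gives zero unless the two
agree. -/
theorem ad_register (T : SuperOp H H) (U : H →ₗᵢ[ℂ] H) (k l : Fin N) :
    ad (TensorProduct.map (LinearMap.id : H →ₗ[ℂ] H)
        (LinearMap.adjoint (registerIsometry N m k).toLinearMap)) ∘ₗ ampl (N * m) T ∘ₗ
      ad (TensorProduct.mapIsometry U (registerIsometry N m l)).toLinearMap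
      = if k = l then ampl m (T ∘ₗ ad U.toLinearMap) else 0 := by
  refine op_tensor_ext fun X Y ↦ ?_
  have h : ad (LinearMap.id : H →ₗ[ℂ] H) = LinearMap.id := by ext; simp [ad_apply]
  rw [LinearMap.comp_apply, LinearMap.comp_apply, TensorProduct.toLinearMap_mapIsometry, ad_map,
    ampl_map, ad_map, h, ← LinearMap.comp_apply (ad _) (ad _), ad_comp,
    adjoint_comp_registerIsometry]
  split_ifs with hkl
  · rw [ampl_map]
    simp [ad_apply]
  · simp [ad_apply]

theorem sum_trace_ad_register (Y : Op (H ⊗[ℂ] Anc (N * m))) :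
    ∑ k, LinearMap.trace ℂ _ (ad (TensorProduct.map (LinearMap.id : H →ₗ[ℂ] H)
        (LinearMap.adjoint (registerIsometry N m k).toLinearMap)) Y) = LinearMap.trace ℂ _ Y := by
  simp only [trace_ad_comm, TensorProduct.adjoint_map, LinearMap.adjoint_adjoint,
    ← TensorProduct.map_comp, LinearMap.adjoint_id, LinearMap.comp_id]
  have h : ∑ k, TensorProduct.map (LinearMap.id : H →ₗ[ℂ] H)
      ((registerIsometry N m k).toLinearMap ∘ₗ
        LinearMap.adjoint (registerIsometry N m k).toLinearMap) = LinearMap.id := by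
    rw [← TensorProduct.map_id, ← sum_registerIsometry_comp_adjoint]
    exact (map_sum (TensorProduct.mapBilinear (.id ℂ) H (Anc (N * m)) H (Anc (N * m))
      LinearMap.id) _ _).symm
  have h' := Finset.sum_mul (R := Op (H ⊗[ℂ] Anc (N * m))) Finset.univ
    (fun k ↦ TensorProduct.map (LinearMap.id : H →ₗ[ℂ] H)
      ((registerIsometry N m k).toLinearMap ∘ₗ
        LinearMap.adjoint (registerIsometry N m k).toLinearMap)) Y
  rw [h] at h'
  rw [← map_sum]
  exact congrArg _ h'.symm

end Register

variable {E : SuperOp Q (H ⊗[ℂ] Anc 2)} {C : SuperOp H H} {D : SuperOp (H ⊗[ℂ] Anc 2) Q}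
  {N : ℕ} {p : Fin N → ℝ}

/-- The classical randomness is moved into the ancilla: `R₀` draws `k`, applies `U_k⁻¹` and records
`k` beside the qubit, and `R₀'` reads `k` to choose the matching `U_k`. -/
theorem isSuperchannel_twirl (hE : IsChannel E) (hC : IsChannel C) (hD : IsChannel D)
    (hp : ∀ k, 0 ≤ p k) (hp1 : ∑ k, p k = 1) (U : Fin N → H ≃ₗᵢ[ℂ] H) :
    IsSuperchannel (twirl E C D p U) := by
  let P (k : Fin N) : SuperOp (H ⊗[ℂ] Anc (N * 2)) (H ⊗[ℂ] Anc 2) :=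
    ad (TensorProduct.map (LinearMap.id : H →ₗ[ℂ] H)
      (LinearMap.adjoint (registerIsometry N 2 k).toLinearMap))
  have hUC (k : Fin N) : IsChannel
      (D ∘ₗ ampl 2 ((U k).toLinearEquiv.conj.toLinearMap ∘ₗ C)) :=
    hD.comp (((isChannel_conj (U k)).comp hC).amplify 2)
  refine ⟨N * 2, ∑ k, (p k : ℂ) • (ad (TensorProduct.mapIsometry
      (U k).symm.toLinearIsometry (registerIsometry N 2 k)).toLinearMap ∘ₗ E),
    ∑ k, (D ∘ₗ ampl 2 ((U k).toLinearEquiv.conj.toLinearMap ∘ₗ C)) ∘ₗ P k,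
    isChannel_convex_sum hp hp1 fun k ↦ (isChannel_ad _).comp hE, ⟨?_, fun Y ↦ ?_⟩, fun T ↦ ?_⟩
  · exact .sum fun k _ ↦ (hUC k).1.comp (isCompletelyPositive_ad _)
  · rw [LinearMap.sum_apply, map_sum, ← sum_trace_ad_register Y]
    exact Finset.sum_congr rfl fun k _ ↦ (hUC k).2 _
  · have key (k l : Fin N) (Z : Op (H ⊗[ℂ] Anc 2)) :
        P k (ampl (N * 2) T (ad (TensorProduct.mapIsometry (U l).symm.toLinearIsometry
          (registerIsometry N 2 l)).toLinearMap Z))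
        = if k = l then ampl 2 (T ∘ₗ (U l).symm.toLinearEquiv.conj.toLinearMap) Z else 0 := by
      have h := LinearMap.congr_fun (ad_register T (U l).symm.toLinearIsometry k l) Z
      rw [← conj_eq_ad] at h
      refine h.trans ?_
      split_ifs <;> rfl
    ext1 σ
    simp only [twirl_apply, LinearMap.sum_apply, LinearMap.smul_apply, LinearMap.comp_apply,
      map_sum, map_smul]
    refine Finset.sum_congr rfl fun k _ ↦ ?_
    simp only [key]
    rw [Finset.sum_eq_single k (fun l _ hl ↦ by simp [hl]) (by simp), if_pos rfl,
      ← LinearMap.comp_apply (ampl 2 _) (ampl 2 _), ← ampl_comp]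
    rfl

theorem isChannel_twirl (hE : IsChannel E) (hC : IsChannel C) (hD : IsChannel D)
    (hp : ∀ k, 0 ≤ p k) (hp1 : ∑ k, p k = 1) (U : Fin N → H ≃ₗᵢ[ℂ] H) {T : SuperOp H H}
    (hT : IsChannel T) : IsChannel (twirl E C D p U T) :=
  isChannel_convex_sum hp hp1 fun k ↦ hD.comp ((((isChannel_conj (U k)).comp
    (hC.comp (hT.comp (isChannel_conj (U k).symm)))).amplify 2).comp hE)

end

/-! ### Encoding, decoding and fixed points. -/

section

variable {H Q : Type*} [NormedAddCommGroup H] [InnerProductSpace ℂ H] [FiniteDimensional ℂ H]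
  [NormedAddCommGroup Q] [InnerProductSpace ℂ Q] [FiniteDimensional ℂ Q]

omit [FiniteDimensional ℂ H] [FiniteDimensional ℂ Q] in
theorem exists_encoding {n : ℕ} (q : OrthonormalBasis (Fin n) ℂ Q) (x : Fin n → H)
    (hx : ∀ i, ‖x i‖ = 1) : ∃ A : Q →ₗᵢ[ℂ] H ⊗[ℂ] Anc n, ∀ i, A (q i) = x i ⊗ₜ ancVec i := by
  refine ⟨LinearMap.isometryOfOrthonormal
    (q.toBasis.constr ℂ fun i ↦ x i ⊗ₜ[ℂ] (ancVec i : Anc n)) (v := q.toBasis)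
    (by simp) ?_, fun i ↦ ?_⟩
  · rw [orthonormal_iff_ite]
    intro i j
    simp only [Function.comp_apply, Module.Basis.constr_basis, TensorProduct.inner_tmul,
      inner_ancVec]
    split_ifs with h
    · simp [h, hx]
    · simp
  · have h := q.toBasis.constr_basis ℂ (fun i ↦ x i ⊗ₜ[ℂ] (ancVec i : Anc n)) i
    rwa [OrthonormalBasis.coe_toBasis] at h

theorem ad_adjoint_encoding {n : ℕ} (q : OrthonormalBasis (Fin n) ℂ Q) {x : Fin n → H}
    {A : Q →ₗᵢ[ℂ] H ⊗[ℂ] Anc n} (hA : ∀ i, A (q i) = x i ⊗ₜ ancVec i) (Z : Op H) (i j : Fin n) :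
    ad (LinearMap.adjoint A.toLinearMap) (TensorProduct.map Z (dyad (ancVec i) (ancVec j)))
      = inner ℂ (x i) (Z (x j)) • dyad (q i) (q j) := by
  have hadj (a : H) (i : Fin n) :
      LinearMap.adjoint A.toLinearMap (a ⊗ₜ ancVec i) = inner ℂ (x i) a • q i := by
    refine InnerProductSpace.ext_inner_right_basis q.toBasis fun k ↦ ?_
    rw [OrthonormalBasis.coe_toBasis, LinearMap.adjoint_inner_left,
      LinearIsometry.coe_toLinearMap, hA, TensorProduct.inner_tmul, inner_ancVec, inner_smul_left,
      orthonormal_iff_ite.1 q.orthonormal, inner_conj_symm]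
    split_ifs with h
    · rw [h]
    · simp
  rw [sum_dyad_eq (stdOrthonormalBasis ℂ H) Z]
  have hm := map_sum ((TensorProduct.mapBilinear (.id ℂ) H (Anc n) H (Anc n)).flip
    (dyad (ancVec i) (ancVec j))) (fun k ↦ dyad (Z (stdOrthonormalBasis ℂ H k))
      (stdOrthonormalBasis ℂ H k)) Finset.univ
  simp only [LinearMap.flip_apply, TensorProduct.mapBilinear_apply] at hm
  rw [hm, map_sum]
  simp only [map_dyad, ad_dyad, hadj, dyad_smul_left, dyad_smul_right, LinearMap.sum_apply,
    inner_sum, dyad_apply, inner_smul_right, Finset.sum_smul, smul_smul, inner_conj_symm]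

theorem recovery_map_dyad {n : ℕ} [NeZero n] (q : OrthonormalBasis (Fin n) ℂ Q) {x : Fin n → H}
    {A : Q →ₗᵢ[ℂ] H ⊗[ℂ] Anc n} (hA : ∀ i, A (q i) = x i ⊗ₜ ancVec i) (Z : Op H) (i j : Fin n) :
    recovery A LinearIsometry.id (q 0) (TensorProduct.map Z (dyad (ancVec i) (ancVec j)))
      = inner ℂ (x i) (Z (x j)) • dyad (q i) (q j) +
        (if i = j then LinearMap.trace ℂ H Z - inner ℂ (x i) (Z (x j)) else 0) •
          dyad (q 0) (q 0) := by
  have hid (X : Op Q) : ad (LinearIsometry.id : Q →ₗᵢ[ℂ] Q).toLinearMap X = X := by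
    simp [ad_apply]
  rw [recovery_apply, hid, ad_adjoint_encoding q hA, LinearMap.trace_tensorProduct', trace_dyad,
    map_smul, trace_dyad, inner_ancVec, orthonormal_iff_ite.1 q.orthonormal]
  by_cases h : i = j
  · simp [h]
  · simp [h, Ne.symm h]

section Twirl

variable {q : OrthonormalBasis (Fin 2) ℂ Q} {x : Fin 2 → H} {A : Q →ₗᵢ[ℂ] H ⊗[ℂ] Anc 2}

/-- The ancilla labels separate the two code vectors, so matrix units do not mix, except that lost
diagonal weight is sent to `|q₀⟩⟨q₀|`. -/
theorem twirl_dyad (hA : ∀ i, A (q i) = x i ⊗ₜ ancVec i) {C : SuperOp H H} (hC : IsChannel C)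
    {N : ℕ} (p : Fin N → ℝ) (U : Fin N → H ≃ₗᵢ[ℂ] H) (T : SuperOp H H) (i j : Fin 2) :
    twirl (ad A.toLinearMap) C (recovery A LinearIsometry.id (q 0)) p U T (dyad (q i) (q j))
      = (∑ k, p k * inner ℂ ((U k).symm (x i))
          (C (T (dyad ((U k).symm (x i)) ((U k).symm (x j)))) ((U k).symm (x j)))) •
            dyad (q i) (q j) +
        (if i = j then ∑ k, p k * (LinearMap.trace ℂ H
          (T (dyad ((U k).symm (x i)) ((U k).symm (x j)))) - inner ℂ ((U k).symm (x i))
          (C (T (dyad ((U k).symm (x i)) ((U k).symm (x j)))) ((U k).symm (x j)))) else 0) •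
            dyad (q 0) (q 0) := by
  simp only [twirl_apply, LinearMap.sum_apply, LinearMap.smul_apply, LinearMap.comp_apply, ad_dyad,
    LinearIsometry.coe_toLinearMap, hA, ← map_dyad, ampl_map, LinearEquiv.coe_coe, conj_dyad,
    recovery_map_dyad q hA, inner_conj_apply, LinearMap.trace_conj', hC.2]
  split_ifs with h
  · simp only [smul_add, smul_smul, Finset.sum_add_distrib, Finset.sum_smul]
  · simp only [smul_add, smul_smul, Finset.sum_add_distrib, Finset.sum_smul, zero_smul, smul_zero,
      Finset.sum_const_zero]

end Twirl

/-- A map that damps everything to `|q₀⟩⟨q₀|` has no other fixed point. -/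
theorem eq_ketbra_iff_fixed (q : OrthonormalBasis (Fin 2) ℂ Q) {S : SuperOp Q Q}
    (c : Fin 2 → Fin 2 → ℂ) (hS : ∀ i j, S (dyad (q i) (q j)) = c i j • dyad (q i) (q j) +
      (if i = j then 1 - c i j else 0) • dyad (q 0) (q 0)) (hc : c 1 1 ≠ 1) {ρ : Op Q}
    (hρ : IsState ρ) : S ρ = ρ ↔ ρ = ketbra (q 0) := by
  rw [ketbra_eq_dyad]
  constructor
  · intro h
    have hin (i j : Fin 2) : inner ℂ (q i) (q j) = if i = j then (1 : ℂ) else 0 :=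
      orthonormal_iff_ite.1 q.orthonormal i j
    have h11 : inner ℂ (q 1) (S ρ (q 1)) = c 1 1 * inner ℂ (q 1) (ρ (q 1)) := by
      conv_lhs => rw [sum_sum_dyad_eq q q ρ]
      simp [Fin.sum_univ_two, hS, dyad_apply, hin, mul_comm]
    have h0 : inner ℂ (q 1) (ρ (q 1)) = 0 := by
      rw [h] at h11
      by_contra hne
      exact hc (mul_right_cancel₀ hne (by rw [← h11, one_mul]))
    refine eq_dyad_self_of_inner_eq_one hρ.1 hρ.2 (q.orthonormal.norm_eq_one 0) ?_
    have ht := LinearMap.trace_eq_sum_inner ρ q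
    rw [hρ.2, Fin.sum_univ_two, h0, add_zero] at ht
    exact ht.symm
  · rintro rfl
    rw [hS]
    simp [← add_smul]

theorem dyad_mem_opsIn {V : Submodule ℂ H} {x y : H} (hx : x ∈ V) (hy : y ∈ V) :
    dyad x y ∈ opsIn V := by
  constructor
  · rintro _ ⟨z, rfl⟩
    exact V.smul_mem _ hx
  · have h : Vᗮ ≤ LinearMap.ker (dyad x y) := fun z hz ↦ by
      rw [LinearMap.mem_ker, dyad_apply, hz y hy, zero_smul]
    exact (Submodule.orthogonal_le h).trans V.orthogonal_orthogonal.le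

theorem eqOn_opsIn {V : Submodule ℂ H} {S T : SuperOp H H}
    (h : ∀ x ∈ V, ∀ y ∈ V, S (dyad x y) = T (dyad x y)) : Set.EqOn S T (opsIn V) := by
  rintro X ⟨hr, hk⟩
  let b := stdOrthonormalBasis ℂ V
  have hX : X = ∑ i, dyad (X (b i)) (b i : H) := by
    ext z
    have h1 : V.starProjection z = ∑ i, inner ℂ (b i : H) z • (b i : H) := by
      rw [b.starProjection_eq_sum_rankOne]
      simp
    have h2 : z - V.starProjection z ∈ LinearMap.ker X := by
      have h3 : Vᗮ ≤ LinearMap.ker X :=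
        (Submodule.orthogonal_le hk).trans (Submodule.orthogonal_orthogonal _).le
      exact h3 (V.sub_starProjection_mem_orthogonal z)
    rw [LinearMap.mem_ker, map_sub, sub_eq_zero] at h2
    rw [h2, h1]
    simp [dyad_apply]
  rw [hX, map_sum, map_sum]
  exact Finset.sum_congr rfl fun i _ ↦ h _ (hr ⟨_, rfl⟩) _ (b i).2

theorem IsIsometricOn.exists_dyad {T : SuperOp H H} {V : Submodule ℂ H}
    (hT : IsIsometricOn T V) :
    ∃ W : V →ₗᵢ[ℂ] H, ∀ x y : V, T (dyad (x : H) (y : H)) = dyad (W x) (W y) := by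
  obtain ⟨W, hW⟩ := hT
  refine ⟨W, fun x y ↦ ?_⟩
  have h (z : V) : LinearMap.adjoint V.subtype (z : H) = z :=
    LinearMap.congr_fun (adjoint_comp_isometry V.subtypeₗᵢ) z
  have h' : toOpOn V (dyad (x : H) (y : H)) = dyad x y := by
    rw [toOpOn, dyad_comp, comp_dyad, h, h]
  rw [hW _ (dyad_mem_opsIn x.2 y.2), h', ← ad_apply, ad_dyad]
  rfl

/-- The replacement state of the recovery must not imitate a correct output in `V`. Either it can be
chosen orthogonal to `V`, or `V = H`, where `W` is onto and nothing gets replaced. -/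
theorem exists_garbage {V : Submodule ℂ H} {v : H} (hv : ‖v‖ = 1) (W : V →ₗᵢ[ℂ] H) :
    ∃ w : H, ‖w‖ = 1 ∧ ((∀ x ∈ V, inner ℂ w x = (0 : ℂ)) ∨ ∀ Y : Op H,
      LinearMap.trace ℂ V (ad (LinearMap.adjoint W.toLinearMap) Y) = LinearMap.trace ℂ H Y) := by
  by_cases hV : V = ⊤
  · refine ⟨v, hv, .inr fun Y ↦ ?_⟩
    let W' := W.toLinearIsometryEquiv (by rw [hV, finrank_top])
    have h : W.toLinearMap ∘ₗ LinearMap.adjoint W.toLinearMap = LinearMap.id := by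
      refine LinearMap.ext fun z ↦ ?_
      obtain ⟨y, rfl⟩ := W'.surjective z
      exact congrArg W (LinearMap.congr_fun (adjoint_comp_isometry W) y)
    rw [trace_ad_comm, LinearMap.adjoint_adjoint, h, LinearMap.id_comp]
  · obtain ⟨z, hz, hz0⟩ := Submodule.exists_mem_ne_zero_of_ne_bot
      (mt Submodule.orthogonal_eq_bot_iff.1 hV)
    refine ⟨((‖z‖⁻¹ : ℝ) : ℂ) • z, ?_, .inl fun x hx ↦ ?_⟩
    · rw [norm_smul]
      simp [hz0]
    · rw [inner_smul_left, inner_eq_zero_symm.1 (hz x hx), mul_zero]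

theorem inner_recovery {V : Submodule ℂ H} {W : V →ₗᵢ[ℂ] H} {w : H}
    (hw : (∀ x ∈ V, inner ℂ w x = (0 : ℂ)) ∨ ∀ Y : Op H,
      LinearMap.trace ℂ V (ad (LinearMap.adjoint W.toLinearMap) Y) = LinearMap.trace ℂ H Y)
    (Y : Op H) (x : V) :
    inner ℂ (x : H) (recovery W V.subtypeₗᵢ w Y (x : H)) = inner ℂ (W x) (Y (W x)) := by
  have h (z : V) : LinearMap.adjoint V.subtypeₗᵢ.toLinearMap (z : H) = z :=
    LinearMap.congr_fun (adjoint_comp_isometry V.subtypeₗᵢ) z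
  have h0 : inner ℂ (x : H) (((LinearMap.trace ℂ H Y -
      LinearMap.trace ℂ V (ad (LinearMap.adjoint W.toLinearMap) Y)) • dyad w w) (x : H))
      = (0 : ℂ) := by
    rcases hw with hw | hw
    · simp [dyad_apply, hw x x.2]
    · simp [hw]
  rw [recovery_apply, LinearMap.add_apply, inner_add_right, h0, add_zero, ad_apply, ad_apply,
    LinearMap.comp_apply, LinearMap.comp_apply, h, ← LinearMap.adjoint_inner_left, h]
  simp [LinearMap.adjoint_inner_right]

/-- Agreement of two maps on `|x⟩⟨y|`, for `x` and `y` from a spanning set, gives agreement on the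
operators on `V`. -/
theorem eqOn_opsIn_of_span {V : Submodule ℂ H} {ι : Type*} {x : ι → H}
    (hx : V ≤ Submodule.span ℂ (Set.range x)) {S T : SuperOp H H}
    (h : ∀ k l, S (dyad (x k) (x l)) = T (dyad (x k) (x l))) : Set.EqOn S T (opsIn V) := by
  have h1 (a : H) (ha : a ∈ Submodule.span ℂ (Set.range x)) (l : ι) :
      S (dyad a (x l)) = T (dyad a (x l)) := by
    induction ha using Submodule.span_induction with
    | mem a ha => obtain ⟨k, rfl⟩ := ha; exact h k l
    | zero => simp [dyad_zero_left]
    | add a b _ _ ha hb => simp only [dyad_add_left, map_add, ha, hb]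
    | smul c a _ ha => simp only [dyad_smul_left, map_smul, ha]
  refine eqOn_opsIn fun a ha b hb ↦ ?_
  have ha' := h1 a (hx ha)
  have hb' := hx hb
  clear hb
  induction hb' using Submodule.span_induction with
  | mem b hb => obtain ⟨l, rfl⟩ := hb; exact ha' l
  | zero => simp [dyad]
  | add b c _ _ hb hc => simp only [dyad_add_right, map_add, hb, hc]
  | smul c b _ hb => simp only [dyad_smul_right, map_smul, hb]

theorem reducedFunctional_dyad (V : Submodule ℂ H) (v : H) (q : Q) (t : Op H →ₗ[ℂ] ℂ) (a b : Q) :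
    reducedFunctional V v q t (dyad a b) = (if 1 < Module.finrank ℂ V then
      (1 / 2 : ℂ) * t ((1 / ((Module.finrank ℂ V : ℂ) - 1)) •
        (V ⊓ (ℂ ∙ v)ᗮ).starProjection.toLinearMap) else 0) * (inner ℂ q a * inner ℂ b q) := by
  have h : LinearMap.trace ℂ Q (ketbra q * dyad a b) = inner ℂ q a * inner ℂ b q := by
    change LinearMap.trace ℂ Q (dyad q q ∘ₗ dyad a b) = _
    rw [comp_dyad, trace_dyad, dyad_apply, inner_smul_right]
  rw [reducedFunctional]
  split_ifs
  · rw [LinearMap.smul_apply, LinearMap.comp_apply, LinearMap.mulLeft_apply, h, smul_eq_mul]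
  · simp

end

end

end QChan

open QChan

/-! ### The reduction superchannel. -/

theorem theorem4p9 {H : Type*} [NormedAddCommGroup H] [InnerProductSpace ℂ H]
    [FiniteDimensional ℂ H] {Q : Type*} [NormedAddCommGroup Q] [InnerProductSpace ℂ Q]
    [FiniteDimensional ℂ Q] (q : OrthonormalBasis (Fin 2) ℂ Q)
    (T : SuperOp H H) (hT : IsChannel T) (V : Submodule ℂ H) (hV : IsIsometricOn T V)
    (v : H) (hvV : v ∈ V) (hv : ‖v‖ = 1) :
    ∃ R : SuperOp H H →ₗ[ℂ] SuperOp Q Q,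
      IsSuperchannel R ∧ IsOneQubitTwirl V v R ∧
      (∀ T' : SuperOp H H, Set.EqOn T T' (opsIn V) → R T' = LinearMap.id) ∧
      (∀ T' : SuperOp H H, IsChannel T' → ¬ Set.EqOn T T' (opsIn V) →
        IsChannel (R T') ∧
          ∀ ρ : Op Q, IsState ρ → (R T' ρ = ρ ↔ ρ = ketbra (q 0))) ∧
      (∀ (T' : SuperOp H H) (t : Op H →ₗ[ℂ] ℂ), IsChannelWithTransmission T' t →
        t (ketbra v) = 0 →
        TransformsFunctional R t (reducedFunctional V v (q 1) t)) := by
  obtain ⟨W, hW⟩ := hV.exists_dyad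
  obtain ⟨w, hw1, hw⟩ := exists_garbage hv W
  obtain ⟨χ, N, U, hU⟩ := exists_isTwirl hvV hv
  let x : Fin 2 → H := ![v, χ]
  have hx (i) : ‖x i‖ = 1 := by
    fin_cases i
    · exact hv
    · exact hU.norm_eq_one
  obtain ⟨A, hA⟩ := exists_encoding q x hx
  let C : SuperOp H H := recovery W V.subtypeₗᵢ w
  have hC : IsChannel C := isChannel_recovery W _ hw1
  let D : SuperOp (H ⊗[ℂ] Anc 2) Q := recovery A LinearIsometry.id (q 0)
  have hD : IsChannel D := isChannel_recovery A _ (q.orthonormal.norm_eq_one 0)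
  have hE : IsChannel (ad A.toLinearMap) := isChannel_ad A
  let p : Fin N → ℝ := fun _ ↦ (N : ℝ)⁻¹
  have hN : (N : ℝ) ≠ 0 := by exact_mod_cast hU.pos.ne'
  have hp (k) : 0 ≤ p k := by positivity
  have hp1 : ∑ k, p k = 1 := by simp [p, hN]
  have hpc : ∑ k, (p k : ℂ) = 1 := by exact_mod_cast hp1
  let R := twirl (ad A.toLinearMap) C D p U
  let y (k : Fin N) (i : Fin 2) : H := (U k).symm (x i)
  have hy0 (k) : y k 0 = v := (U k).symm_apply_eq.2 (hU.fix k).symm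
  have hyV (k i) : y k i ∈ V := by
    fin_cases i
    · exact (hy0 k).symm ▸ hvV
    · exact hU.mem k
  have hy (k i) : ‖y k i‖ = 1 := ((U k).symm.norm_map _).trans (hx i)
  have hyy (k i) : inner ℂ (y k i) (y k i) = (1 : ℂ) := by
    simp [inner_self_eq_norm_sq_to_K, hy]
  have hR (S : SuperOp H H) (i j : Fin 2) := twirl_dyad hA hC p U S i j
  refine ⟨R, isSuperchannel_twirl hE hC hD hp hp1 U, ⟨_, C, D, N, p, U, hE, hC, hD, hp, hp1,
    fun k ↦ ⟨hU.fix k, hU.fix_orthogonal k⟩, fun S ↦ rfl⟩, fun T' hT' ↦ ?_,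
    fun T' hT' hne ↦ ⟨isChannel_twirl hE hC hD hp hp1 U hT', fun ρ hρ ↦ ?_⟩,
    fun T' t ht htv n R₀ R₀' hRimpl ↦ ?_⟩
  · have hT'y (k i j) : T' (dyad (y k i) (y k j))
        = ad W.toLinearMap (dyad (⟨y k i, hyV k i⟩ : V) ⟨y k j, hyV k j⟩) := by
      rw [← hT' (dyad_mem_opsIn (hyV k i) (hyV k j)), ad_dyad]
      exact hW ⟨y k i, hyV k i⟩ ⟨y k j, hyV k j⟩
    have hCy (k i j) : C (T' (dyad (y k i) (y k j))) = dyad (y k i) (y k j) := by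
      rw [hT'y, recovery_ad, ad_dyad]
      rfl
    refine op_basis_ext q fun i j ↦ ?_
    refine (hR T' i j).trans ?_
    have h1 (k) : inner ℂ (y k i) (C (T' (dyad (y k i) (y k j))) (y k j)) = 1 := by
      rw [hCy, dyad_apply, inner_smul_right, hyy, hyy, one_mul]
    have h2 (k) : LinearMap.trace ℂ H (T' (dyad (y k i) (y k j))) = inner ℂ (y k j) (y k i) := by
      rw [← hC.2, hCy, trace_dyad]
    change (∑ k, (p k : ℂ) * inner ℂ (y k i) (C (T' (dyad (y k i) (y k j))) (y k j))) • _ +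
      (if i = j then ∑ k, (p k : ℂ) * (LinearMap.trace ℂ H (T' (dyad (y k i) (y k j))) -
        inner ℂ (y k i) (C (T' (dyad (y k i) (y k j))) (y k j))) else 0) • _ = _
    simp only [h1, h2, mul_one, hpc, one_smul]
    split_ifs with hij
    · subst hij
      simp only [hyy, sub_self, mul_zero, Finset.sum_const_zero, zero_smul, add_zero]
      rfl
    · simp
  · let c (i j : Fin 2) : ℂ :=
      ∑ k, p k * inner ℂ (y k i) (C (T' (dyad (y k i) (y k j))) (y k j))
    refine eq_ketbra_iff_fixed q c (fun i j ↦ ?_) (fun hc ↦ hne ?_) hρ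
    · refine (hR T' i j).trans ?_
      congr 2
      split_ifs with hij
      · subst hij
        simp only [mul_sub, Finset.sum_sub_distrib, hT'.2, trace_dyad]
        congr 1
        rw [← hpc]
        exact Finset.sum_congr rfl fun k _ ↦ by rw [hyy, mul_one]
      · rfl
    · have hpos (k) : (T' (dyad (y k 1) (y k 1))).IsPositive :=
        hT'.1.isPositive (isPositive_dyad_self _)
      have htr (k) : LinearMap.trace ℂ H (T' (dyad (y k 1) (y k 1))) = 1 := by
        rw [hT'.2, trace_dyad, hyy]
      have hle (k) : inner ℂ (y k 1) (C (T' (dyad (y k 1) (y k 1))) (y k 1)) ≤ (1 : ℂ) := by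
        refine (inner_le_trace (hC.1.isPositive (hpos k)) (hy k 1)).trans_eq ?_
        rw [hC.2, htr]
      -- The average of overlaps that are at most 1 equals 1, and all weights are positive, so every
      -- overlap is 1.
      have hsum : ∑ k, (p k : ℂ) *
          (1 - inner ℂ (y k 1) (C (T' (dyad (y k 1) (y k 1))) (y k 1))) = 0 := by
        simp only [mul_sub, Finset.sum_sub_distrib, mul_one, hpc]
        rw [sub_eq_zero]
        exact hc.symm
      rw [Finset.sum_eq_zero_iff_of_nonneg fun k _ ↦
        mul_nonneg (by exact_mod_cast hp k) (sub_nonneg.2 (hle k))] at hsum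
      have hfix (k) : T' (dyad (y k 1) (y k 1)) = dyad (W ⟨y k 1, hyV k 1⟩) (W ⟨y k 1, hyV k 1⟩) := by
        refine eq_dyad_self_of_inner_eq_one (hpos k) (htr k) ((W.norm_map _).trans (hy k 1)) ?_
        rw [← inner_recovery hw]
        have h := (mul_eq_zero.1 (hsum k (Finset.mem_univ k))).resolve_left (by
          simpa [p] using hU.pos.ne')
        exact (sub_eq_zero.1 h).symm
      refine eqOn_opsIn_of_span hU.le_span fun k l ↦ ?_
      change T (dyad (y k 1) (y l 1)) = T' (dyad (y k 1) (y l 1))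
      rw [hT'.apply_dyad ((W.norm_map _).trans (hy k 1)) ((W.norm_map _).trans (hy l 1))
        (hfix k) (hfix l) (W.inner_map_map _ _) (hU.inner_ne_zero l k)]
      exact hW ⟨y k 1, hyV k 1⟩ ⟨y l 1, hyV l 1⟩
  · refine op_basis_ext q fun i j ↦ ?_
    have hvt : LinearMap.trace ℂ H (dyad v v) = 1 := by
      rw [trace_dyad, inner_self_eq_norm_sq_to_K, hv]
      simp
    -- `R₀'` preserves the trace, so the implementation drops out. The state `|v⟩⟨v|` serves only as
    -- an operator of trace 1.
    have himpl : t (ptrace n (R₀ (dyad (q i) (q j))))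
        = LinearMap.trace ℂ Q (R (t.smulRight (dyad v v)) (dyad (q i) (q j))) := by
      rw [hRimpl.2.2, LinearMap.comp_apply, LinearMap.comp_apply, hRimpl.2.1.2,
        trace_ampl_functional n t hvt]
    rw [LinearMap.comp_apply, LinearMap.comp_apply, himpl]
    rw [hR, map_add, map_smul, map_smul, trace_dyad, trace_dyad, reducedFunctional_dyad,
      ← hU.average t ht.2 htv, orthonormal_iff_ite.1 q.orthonormal,
      orthonormal_iff_ite.1 q.orthonormal, orthonormal_iff_ite.1 q.orthonormal,
      orthonormal_iff_ite.1 q.orthonormal]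
    by_cases hij : i = j
    swap
    · have h : ¬ (1 = i ∧ j = 1) := fun h ↦ hij (h.1.symm.trans h.2.symm)
      rw [if_neg hij, if_neg (Ne.symm hij), ite_zero_mul_ite_zero, if_neg h]
      simp
    subst hij
    simp only [if_true, smul_eq_mul, mul_one, mul_sub, Finset.sum_sub_distrib, add_sub_cancel,
      LinearMap.smulRight_apply, map_smul, hvt]
    change ∑ k, (p k : ℂ) * t (dyad (y k i) (y k i))
      = (∑ k, (N : ℂ)⁻¹ * t (dyad (y k 1) (y k 1))) * _
    fin_cases i
    · have htv' : t (dyad v v) = 0 := htv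
      simp [hy0, htv']
    · simp [p]
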